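/- A robust factored MDP (RFMDP) $\mathcal R$ with $N\ge 1$ sub-states consists of finite sub-state spaces $\mathcal S_1,\dots,\mathcal S_N$ with $\mathcal S=\prod_{n}\mathcal S_n$, a finite non-empty action space $\mathcal A$, a feature map $\phi$ on $\mathcal S\times\mathcal A$ with values in a set $\Phi$, initial distributions $q_n\in\Delta(\mathcal S_n)$, marginal ambiguity sets $\mathcal P^n(\varphi)\subseteq\Delta(\mathcal S_n)$, $\varphi\in\Phi$, that are polyhedra and are non-empty for all $\varphi=\phi(s,a)$, rewards $r(\phi(s,a))\in\mathbb R$, and a discount factor $\gamma\in(0,1)$. (Binary instances have $\mathcal S_n=\{0,1\}$, $\mathcal A\subseteq\{0,1\}^k$ and $\Phi=\{0,1\}^F$.) For a policy $\pi:\mathcal S\to\mathcal A$ and a kernel $p:\Phi\to\Delta(\mathcal S)$, let $\mathbb E_p^\pi\big[\sum_{t\ge0}\gamma^t\, r(\phi(\tilde s^t,\pi(\tilde s^t)))\big]$ be the expected total reward of the Markov chain with initial distribution $\prod_n q_n$ and transition probabilities $p(\cdot\,|\,\phi(s,\pi(s)))$. Let $\mathcal P^{\mathrm{NF}}$ be the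 set of all kernels $p$ such that for all $(s,a)\in\mathcal S\times\mathcal A$ and all $n$ the $n$-th marginal of $p(\cdot|\phi(s,a))$ lies in $\mathcal P^n(\phi(s,a))$, and $\mathcal P^{\mathrm F}$ the set of all kernels $p$ such that for all $(s,a)\in\mathcal S\times\mathcal A$ the distribution $p(\cdot|\phi(s,a))$ is a product $\prod_n p_n$ with $p_n\in\mathcal P^n(\phi(s,a))$. Let $\mathrm{NF}(\pi;\mathcal R)$ and $\mathrm F(\pi;\mathcal R)$ be the infima of the expected total reward over $p\in\mathcal P^{\mathrm{NF}}$ and $p\in\mathcal P^{\mathrm F}$, and let $\mathrm{NF}^\star(\mathcal R)$, $\mathrm F^\star(\mathcal R)$ be their suprema over $\pi$. Fix $s^0\in\mathcal S$ and $a^0\in\mathcal A$. The lift of $\mathcal R$ is the RFMDP with states $\hat s=(u,m,a,n)\in\mathcal S\times\mathcal S\times\mathcal A\times[N]$, whose $2N+2$ sub-states are the components of $u$ and $m$ as well as $a$ and $n$, with action space $\mathcal A$, discount factor $\gamma^{1/N}$, and an initial state $(u,s^0,a^0,1)$ with $u\sim\prod_n q_n$. Its feature map sends $(\hat s,\hat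 a)$ to $(\hat s,\hat a,\phi(u,\hat a),\phi(m,a))$, so its kernels may depend on the full lifted state and action. When action $\hat a$ is taken in state $(u,m,a,n)$, the reward is $r(\phi(u,\hat a))$ if $(m,a,n)=(s^0,a^0,1)$ and $0$ otherwise, and the marginal ambiguity sets prescribe that $u'_n$ follows some distribution in $\mathcal P^n(\phi(u,\hat a))$ if $n=1$ and in $\mathcal P^n(\phi(m,a))$ if $n>1$, while deterministically $u'_\eta=u_\eta$ for $\eta\neq n$, $n'=n+1$ for $n<N$ and $n'=1$ for $n=N$, and $(m',a')=(s^0,a^0)$ if $n=N$, $(m',a')=(u,\hat a)$ if $n=1<N$, and $(m',a')=(m,a)$ otherwise. For $\hat\pi:\hat{\mathcal S}\to\mathcal A$ let $\mathrm L(\hat\pi;\mathcal R)$ be the non-factored objective of the lift, $\mathrm L^\star(\mathcal R)=\sup_{\hat\pi}\mathrm L(\hat\pi;\mathcal R)$, and for a policy $\pi$ of $\mathcal R$ let $\hat\Pi(\pi)$ be the set of all $\hat\pi$ with $\hat\pi(u,s^0,a^0,1)=\pi(u)$ for all $u\in\mathcal S$. Theorem. (i) For every RFMDP $\mathcal R$,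 all $s^0$, $a^0$, every policy $\pi$ and every $\hat\pi\in\hat\Pi(\pi)$, $\mathrm{NF}(\pi;\mathcal R)\le\mathrm L(\hat\pi;\mathcal R)\le\mathrm F(\pi;\mathcal R)$. Moreover, each of the four patterns $\mathrm{NF}<\mathrm L<\mathrm F$, $\mathrm{NF}=\mathrm L<\mathrm F$, $\mathrm{NF}<\mathrm L=\mathrm F$ and $\mathrm{NF}=\mathrm L=\mathrm F$ occurs for some binary instance $\mathcal R$ and some policy $\pi$, for all $s^0$, $a^0$ and all $\hat\pi\in\hat\Pi(\pi)$. (ii) For every $N\ge1$ and $\gamma\in(0,1)$ there is a binary RFMDP $\mathcal R$ with $N$ sub-states, discount factor $\gamma$ and rewards in $\{0,1\}$ such that $\mathrm{NF}^\star(\mathcal R)=\mathrm L^\star(\mathcal R)=0$ (for all $s^0$, $a^0$) while $\mathrm F^\star(\mathcal R)=\gamma(1-\gamma)^{-1}\big(1-2^{-\lfloor N/2\rfloor}\big)$. (iii) For every $N\ge1$ and $\gamma\in(0,1)$ there is a binary RFMDP $\mathcal R$ with $N$ sub-states, discount factor $\gamma$ and rewards in $\{0,1\}$ such that $\mathrm{NF}^\star(\mathcal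 R)=0$ while $\mathrm L^\star(\mathcal R)=\mathrm F^\star(\mathcal R)=\gamma(1-\gamma)^{-1}\big(1-2^{-(N-1)}\big)$ (for all $s^0$, $a^0$). -/

import Mathlib

open MeasureTheory ProbabilityTheory

noncomputable section

/-! ### Discounted rewards of finite Markov chains

`stdSimplex ℝ X` is the set `Δ(X)` of probability distributions on the finite set `X`. -/

/-- The distribution `p ∈ Δ(X)`, viewed as a measure on `X`. -/
def simplexMeasure {X : Type} [Fintype X] [MeasurableSpace X] (p : stdSimplex ℝ X) : Measure X :=
  ∑ x, ENNReal.ofReal (p x) • Measure.dirac x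

instance simplexMeasure_isProbabilityMeasure {X : Type} [Fintype X] [MeasurableSpace X]
    (p : stdSimplex ℝ X) : IsProbabilityMeasure (simplexMeasure p) := by
  constructor
  have h : ∑ x, ENNReal.ofReal (p x) = 1 := by
    change ∑ x, ENNReal.ofReal (p.1 x) = 1
    rw [← ENNReal.ofReal_sum_of_nonneg (fun x _ => p.2.1 x), p.2.2, ENNReal.ofReal_one]
  simp [simplexMeasure, h]

/-- The one-step transition kernel of the Markov chain with transition probabilities `K x`. -/
def stepKernel {X : Type} [Fintype X] [MeasurableSpace X] [DiscreteMeasurableSpace X]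
    (K : X → stdSimplex ℝ X) : Kernel X X :=
  Kernel.ofFunOfCountable fun x => simplexMeasure (K x)

instance stepKernel_isMarkovKernel {X : Type} [Fintype X] [MeasurableSpace X]
    [DiscreteMeasurableSpace X] (K : X → stdSimplex ℝ X) : IsMarkovKernel (stepKernel K) :=
  ⟨fun x => simplexMeasure_isProbabilityMeasure (K x)⟩

/-- The law, on the space of trajectories `ℕ → X`, of the time-homogeneous Markov chain with
initial distribution `q` and transition probabilities `K`. -/
def chainLaw {X : Type} [Fintype X] [MeasurableSpace X] [DiscreteMeasurableSpace X]
    (q : stdSimplex ℝ X) (K : X → stdSimplex ℝ X) : Measure (ℕ → X) :=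
  Kernel.trajMeasure (X := fun _ => X) (simplexMeasure q) fun t =>
    (stepKernel K).comap (fun ω : (i : Finset.Iic t) → X => ω ⟨t, Finset.mem_Iic.2 le_rfl⟩)
      (measurable_pi_apply _)

/-- `𝔼 [∑ₜ γᵗ c(s̃ᵗ) | s̃⁰ ∼ q]` for the Markov chain with transition probabilities `K`. -/
def expectedTotalReward {X : Type} [Fintype X] (q : stdSimplex ℝ X) (K : X → stdSimplex ℝ X)
    (c : X → ℝ) (γ : ℝ) : ℝ :=
  letI : MeasurableSpace X := ⊤
  ∫ ω, ∑' t : ℕ, γ ^ t * c (ω t) ∂(chainLaw q K)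

/-! ### Product distributions, marginals, polyhedra -/

/-- The product distribution `s ↦ ∏ₙ qₙ(sₙ)`. -/
def productDistribution {ι : Type} [Fintype ι] [DecidableEq ι] {S : ι → Type}
    [∀ i, Fintype (S i)] (q : ∀ i, stdSimplex ℝ (S i)) : stdSimplex ℝ (∀ i, S i) :=
  ⟨fun s => ∏ i, q i (s i), fun _ => Finset.prod_nonneg fun i _ => (q i).2.1 _, by
    rw [← Fintype.prod_sum]
    exact Finset.prod_eq_one fun i _ => (q i).2.2⟩

open Classical in
/-- The marginal distribution of the `i`-th component of `p`. -/
def marg {ι : Type} [Fintype ι] [DecidableEq ι] {S : ι → Type} [∀ i, Fintype (S i)]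
    (p : stdSimplex ℝ (∀ i, S i)) (i : ι) : S i → ℝ :=
  fun σ => ∑ s, if s i = σ then p s else 0

/-- A polyhedron: the solution set of a finite system of linear inequalities `G x ≤ h`. -/
def IsPolyhedron {X : Type} [Fintype X] (C : Set (X → ℝ)) : Prop :=
  ∃ (m : ℕ) (G : Matrix (Fin m) X ℝ) (h : Fin m → ℝ), C = {x | G.mulVec x ≤ h}

theorem isPolyhedron_singleton {X : Type} [Fintype X] (y : X → ℝ) : IsPolyhedron {y} := by
  classical
  let e := Fintype.equivFin (X ⊕ X)
  refine ⟨Fintype.card (X ⊕ X),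
    fun k x => Sum.elim (fun z => if z = x then 1 else 0) (fun z => if z = x then -1 else 0)
      (e.symm k),
    fun k => Sum.elim (fun z => y z) (fun z => -y z) (e.symm k), ?_⟩
  ext x
  simp only [Set.mem_singleton_iff, Set.mem_ofPred_eq, Pi.le_def, Matrix.mulVec, dotProduct]
  rw [← e.forall_congr_right]
  simp only [Equiv.symm_apply_apply, Sum.forall, Sum.elim_inl, Sum.elim_inr, ite_mul, one_mul,
    neg_mul, zero_mul, Finset.sum_ite_eq, Finset.mem_univ, if_true, neg_le_neg_iff]
  rw [funext_iff]
  exact ⟨fun h => ⟨fun z => (h z).le, fun z => (h z).ge⟩,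
    fun h z => le_antisymm (h.1 z) (h.2 z)⟩

/-! ### Robust factored MDPs -/

/-- A robust (feature-based) factored MDP `(𝒮, 𝒜, φ, q, 𝒫, r, γ)` with finite sub-state spaces
`S i`, state space `∀ i, S i`, action space `A` and feature space `Φ`. The ambiguity set is
described by the marginal ambiguity sets `P i f ⊆ Δ(S i)`; `r` is the total one-step reward
(the sum of all reward components). -/
structure RFMDP {ι : Type} (S : ι → Type) [∀ i, Fintype (S i)] (A Φ : Type) where
  /-- the feature map -/
  φ : (∀ i, S i) → A → Φ
  /-- the initial distributions of the sub-states -/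
  q : ∀ i, stdSimplex ℝ (S i)
  /-- the marginal ambiguity sets -/
  P : ∀ i, Φ → Set (S i → ℝ)
  P_subset : ∀ i f, P i f ⊆ stdSimplex ℝ (S i)
  P_polyhedral : ∀ i f, IsPolyhedron (P i f)
  P_nonempty : ∀ i s a, (P i (φ s a)).Nonempty
  /-- the rewards -/
  r : Φ → ℝ
  /-- the discount factor -/
  γ : ℝ
  γ_pos : 0 < γ
  γ_lt_one : γ < 1

namespace RFMDP

section Objectives

variable {ι : Type} [Fintype ι] [DecidableEq ι] {S : ι → Type} [∀ i, Fintype (S i)] {A Φ : Type}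

/-- The expected total reward of the stationary policy `π` under the transition kernel `p`. -/
def value (R : RFMDP S A Φ) (π : (∀ i, S i) → A) (p : Φ → stdSimplex ℝ (∀ i, S i)) : ℝ :=
  expectedTotalReward (productDistribution R.q) (fun s => p (R.φ s (π s)))
    (fun s => R.r (R.φ s (π s))) R.γ

/-- The non-factored ambiguity set `𝒫^NF`: all marginals lie in the marginal ambiguity sets. -/
def nonFactoredSet (R : RFMDP S A Φ) : Set (Φ → stdSimplex ℝ (∀ i, S i)) :=
  {p | ∀ s a i, marg (p (R.φ s a)) i ∈ R.P i (R.φ s a)}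

/-- The factored ambiguity set `𝒫^F`: products of elements of the marginal ambiguity sets. -/
def factoredSet (R : RFMDP S A Φ) : Set (Φ → stdSimplex ℝ (∀ i, S i)) :=
  {p | ∀ s a, ∃ pm : ∀ i, S i → ℝ, (∀ i, pm i ∈ R.P i (R.φ s a)) ∧
    ∀ s' : ∀ i, S i, p (R.φ s a) s' = ∏ i, pm i (s' i)}

/-- The non-factored objective `NF(π)`. -/
def NF (R : RFMDP S A Φ) (π : (∀ i, S i) → A) : ℝ := ⨅ p : R.nonFactoredSet, R.value π p

/-- The factored objective `F(π)`. -/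
def F (R : RFMDP S A Φ) (π : (∀ i, S i) → A) : ℝ := ⨅ p : R.factoredSet, R.value π p

/-- The optimal value `NF*`. -/
def NFopt (R : RFMDP S A Φ) : ℝ := ⨆ π, R.NF π

/-- The optimal value `F*`. -/
def Fopt (R : RFMDP S A Φ) : ℝ := ⨆ π, R.F π

/-- All rewards are `0` or `1`. -/
def ZeroOneRewards (R : RFMDP S A Φ) : Prop :=
  ∀ s a, R.r (R.φ s a) = 0 ∨ R.r (R.φ s a) = 1

end Objectives

end RFMDP

/-! ### The lift -/

/-- The `2N + 2` sub-states of the lift: `N` for the update block, `N` for the memory block, one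
for the action block, one for the timer block. -/
inductive LiftIdx (N : ℕ) : Type
  | upd (k : Fin N)
  | mem (k : Fin N)
  | act
  | timer
  deriving DecidableEq, Fintype

/-- The sub-state spaces of the lift. The timer values `1, …, N` are represented by
`0, …, N - 1 : Fin N`. -/
def LiftSub {N : ℕ} (S : Fin N → Type) (A : Type) : LiftIdx N → Type
  | .upd k => S k
  | .mem k => S k
  | .act => A
  | .timer => Fin N

instance liftSubFintype {N : ℕ} (S : Fin N → Type) [∀ n, Fintype (S n)] (A : Type) [Fintype A] :
    ∀ i, Fintype (LiftSub S A i)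
  | .upd k => inferInstanceAs (Fintype (S k))
  | .mem k => inferInstanceAs (Fintype (S k))
  | .act => inferInstanceAs (Fintype A)
  | .timer => inferInstanceAs (Fintype (Fin N))

/-- The lifted state space. -/
abbrev LiftState {N : ℕ} (S : Fin N → Type) (A : Type) : Type := ∀ i, LiftSub S A i

namespace LiftState

variable {N : ℕ} {S : Fin N → Type} {A : Type}

/-- The lifted state `(u, m, a, n)`. -/
def mk (u m : ∀ n, S n) (a : A) (n : Fin N) : LiftState S A
  | .upd k => u k
  | .mem k => m k
  | .act => a
  | .timer => n

/-- The update block. -/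
def u (x : LiftState S A) : ∀ n, S n := fun k => x (.upd k)

/-- The memory block. -/
def m (x : LiftState S A) : ∀ n, S n := fun k => x (.mem k)

/-- The action block. -/
def a (x : LiftState S A) : A := x .act

/-- The timer block. -/
def n (x : LiftState S A) : Fin N := x .timer

end LiftState

/-- The values of the lifted feature map: the lifted state, the lifted action, and the features
`φ(u, â)` and `φ(m, a)`. -/
structure LiftFeature {N : ℕ} (S : Fin N → Type) (A Φ : Type) where
  state : LiftState S A
  action : A
  fu : Φ
  fm : Φ

section PointMass

variable {X : Type} [Fintype X]

open Classical in
/-- The Dirac distribution at `x`. -/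
def pointMass (x : X) : stdSimplex ℝ X :=
  ⟨fun y => if y = x then 1 else 0, fun y => by dsimp only; split_ifs <;> norm_num, by simp⟩

end PointMass

namespace RFMDP

section Lift

variable {N : ℕ} [NeZero N] {S : Fin N → Type} [∀ n, Fintype (S n)] {A : Type} [Fintype A]
  {Φ : Type}

/-- The marginal ambiguity set of the `k`-th sub-state of the update block: it is updated by a
distribution from the `k`-th marginal ambiguity set of `R` if the timer is at `k`, and left
unchanged otherwise. -/
def updP (R : RFMDP S A Φ) (k : Fin N) (f : LiftFeature S A Φ) : Set (S k → ℝ) :=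
  if f.state.n = k then R.P k (if k = 0 then f.fu else f.fm)
  else {(pointMass (f.state.u k)).1}

/-- The marginal ambiguity sets of the lift. With the timer in `Fin N`, `n = 0` is the first
and `n + 1 = 0` the last of the `N` consecutive transitions that make up one transition of `R`. -/
def liftP (R : RFMDP S A Φ) (s₀ : ∀ n, S n) (a₀ : A) :
    ∀ i, LiftFeature S A Φ → Set (LiftSub S A i → ℝ)
  | .upd k, f => R.updP k f
  | .mem k, f =>
      {(pointMass (if f.state.n + 1 = 0 then s₀ k
        else if f.state.n = 0 then f.state.u k else f.state.m k)).1}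
  | .act, f =>
      {(pointMass (if f.state.n + 1 = 0 then a₀
        else if f.state.n = 0 then f.action else f.state.a)).1}
  | .timer, f => {(pointMass (f.state.n + 1)).1}

/-- The initial distributions of the sub-states of the lift. -/
def liftq (R : RFMDP S A Φ) (s₀ : ∀ n, S n) (a₀ : A) : ∀ i, stdSimplex ℝ (LiftSub S A i)
  | .upd k => R.q k
  | .mem k => pointMass (s₀ k)
  | .act => pointMass a₀
  | .timer => pointMass (0 : Fin N)

open Classical in
/-- The lift of `R` relative to the fixed state `s₀` and action `a₀`. -/
def lift (R : RFMDP S A Φ) (s₀ : ∀ n, S n) (a₀ : A) :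
    RFMDP (LiftSub S A) A (LiftFeature S A Φ) where
  φ x b := ⟨x, b, R.φ (LiftState.u x) b, R.φ (LiftState.m x) (LiftState.a x)⟩
  q := R.liftq s₀ a₀
  P := R.liftP s₀ a₀
  P_subset := by
    rintro (k | k | _ | _) f
    · change R.updP k f ⊆ stdSimplex ℝ (S k)
      unfold updP
      split
      · exact R.P_subset _ _
      · exact Set.singleton_subset_iff.2 (Subtype.property _)
    all_goals exact Set.singleton_subset_iff.2 (Subtype.property _)
  P_polyhedral := by
    rintro (k | k | _ | _) f
    · change IsPolyhedron (R.updP k f)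
      unfold updP
      split
      · exact R.P_polyhedral _ _
      · exact isPolyhedron_singleton (X := S k) _
    · exact isPolyhedron_singleton (X := S k) _
    · exact isPolyhedron_singleton (X := A) _
    · exact isPolyhedron_singleton (X := Fin N) _
  P_nonempty := by
    rintro (k | k | _ | _) x b
    · change (R.updP k ⟨x, b, R.φ (LiftState.u x) b, R.φ (LiftState.m x) (LiftState.a x)⟩).Nonempty
      unfold updP
      split
      · by_cases h : k = 0
        · simpa [h] using R.P_nonempty _ _ _
        · simpa [h] using R.P_nonempty _ _ _
      · exact Set.singleton_nonempty _
    all_goals exact Set.singleton_nonempty _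
  r f := if f.state.m = s₀ ∧ f.state.a = a₀ ∧ f.state.n = 0 then R.r f.fu else 0
  γ := R.γ ^ (1 / (N : ℝ))
  γ_pos := Real.rpow_pos_of_pos R.γ_pos _
  γ_lt_one := Real.rpow_lt_one R.γ_pos.le R.γ_lt_one
    (one_div_pos.2 (Nat.cast_pos.2 (Nat.pos_of_ne_zero (NeZero.ne N))))

/-- The lifted non-factored objective `L(π̂)`. -/
def L (R : RFMDP S A Φ) (s₀ : ∀ n, S n) (a₀ : A) (πl : LiftState S A → A) : ℝ :=
  (R.lift s₀ a₀).NF πl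

/-- The optimal value `L*`. -/
def Lopt (R : RFMDP S A Φ) (s₀ : ∀ n, S n) (a₀ : A) : ℝ := ⨆ πl, R.L s₀ a₀ πl

end Lift

end RFMDP

/-- The set `Π̂(π)` of lifted policies associated with the policy `π`. -/
def liftedPolicies {N : ℕ} [NeZero N] {S : Fin N → Type} {A : Type} (s₀ : ∀ n, S n) (a₀ : A)
    (π : (∀ n, S n) → A) : Set (LiftState S A → A) :=
  {πl | ∀ u : ∀ n, S n, πl (LiftState.mk u s₀ a₀ 0) = π u}

/-- RFMDP instances with `N` binary sub-states, actions in `A ⊆ {0,1}^k` and features in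
`{0,1}^F`. -/
abbrev BinaryRFMDP (N : ℕ) {k : ℕ} (A : Finset (Fin k → Bool)) (F : ℕ) :=
  RFMDP (fun _ : Fin N => Bool) A (Fin F → Bool)

end

/-!
Each of the three objectives is the expectation, under the initial distribution, of the solution of
a Bellman equation `V(s) = r(s) + γ 𝓔ₛ[V]`. In the non-factored model `𝓔ₛ` is the lower expectation
over all couplings of the marginal ambiguity sets, in the factored model the lower expectation over
their products. In the lift, `N` transitions with discount factor `γ^(1/N)` make up one transition
of the original model, and `𝓔ₛ` becomes a nested lower expectation: nature draws the sub-states one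
after the other and sees the earlier draws. Since the marginal ambiguity sets are convex,
conditional draws glue to a coupling, whence `NF ≤ L`; independent draws are conditional draws that
ignore the past, whence `L ≤ F`. The functionals `𝓔ₛ` are monotone and translation equivariant, so
inequalities between them carry over to the solutions of the Bellman equations.

In the separating instances the next state does not depend on the current one, so that the values
are `γ / (1 - γ)` times one-step lower expectations. Some sub-states are fair coins, the others are
unrestricted: in the lift, nature can let an unrestricted sub-state copy an earlier coin, but only
in the non-factored model can it correlate two coins.
-/

noncomputable section

/-! ### Expectations on finite sets -/

section Expectation

variable {X Y : Type} [Fintype X] [Fintype Y]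

/-- The expectation of `f` under the distribution `p ∈ Δ(X)`. -/
def expectation (p : stdSimplex ℝ X) (f : X → ℝ) : ℝ := ∑ x, p x * f x

theorem expectation_const (p : stdSimplex ℝ X) (a : ℝ) : expectation p (fun _ => a) = a := by
  have h : ∑ x, p x = 1 := p.2.2
  rw [expectation, ← Finset.sum_mul, h, one_mul]

theorem expectation_le_expectation {p : stdSimplex ℝ X} {f g : X → ℝ}
    (h : ∀ x, p x ≠ 0 → f x ≤ g x) : expectation p f ≤ expectation p g := by
  refine Finset.sum_le_sum fun x _ => ?_
  rcases eq_or_ne (p x) 0 with hx | hx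
  · simp [hx]
  · exact mul_le_mul_of_nonneg_left (h x hx) (p.2.1 x)

theorem expectation_mono (p : stdSimplex ℝ X) : Monotone (expectation p) :=
  fun _ _ h => expectation_le_expectation fun x _ => h x

theorem expectation_add (p : stdSimplex ℝ X) (f g : X → ℝ) :
    expectation p (fun x => f x + g x) = expectation p f + expectation p g := by
  simp only [expectation, mul_add, Finset.sum_add_distrib]

theorem expectation_const_mul (p : stdSimplex ℝ X) (a : ℝ) (f : X → ℝ) :
    expectation p (fun x => a * f x) = a * expectation p f := by
  simp only [expectation, Finset.mul_sum, mul_left_comm]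

theorem expectation_pi_single [DecidableEq X] (p : stdSimplex ℝ X) (x : X) :
    expectation p (Pi.single x 1) = p x := by
  simp [expectation, Pi.single_apply]

theorem stdSimplex_ext_expectation {p q : stdSimplex ℝ X}
    (h : ∀ f, expectation p f = expectation q f) : p = q := by
  classical
  refine Subtype.ext (funext fun x => ?_)
  exact (expectation_pi_single p x).symm.trans ((h _).trans (expectation_pi_single q x))

theorem pointMass_apply [DecidableEq X] (x y : X) : pointMass x y = if y = x then 1 else 0 := by
  by_cases h : y = x
  · exact (if_pos h).trans (if_pos h).symm
  · exact (if_neg h).trans (if_neg h).symm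

theorem expectation_pointMass (x : X) (f : X → ℝ) : expectation (pointMass x) f = f x := by
  classical
  simp [expectation, pointMass_apply]

/-- The mixture of the distributions `ρ x` with weights `p x`: the law of a point drawn from
`ρ x` after drawing `x` from `p`. -/
def mixture (p : stdSimplex ℝ X) (ρ : X → stdSimplex ℝ Y) : stdSimplex ℝ Y :=
  ⟨fun y => expectation p fun x => ρ x y,
    fun y => Finset.sum_nonneg fun x _ => mul_nonneg (p.2.1 x) ((ρ x).2.1 y), by
      have h : ∀ x, ∑ y, ρ x y = 1 := fun x => (ρ x).2.2
      simp only [expectation]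
      rw [Finset.sum_comm]
      simp only [← Finset.mul_sum, h, mul_one]
      exact p.2.2⟩

theorem expectation_mixture (p : stdSimplex ℝ X) (ρ : X → stdSimplex ℝ Y) (f : Y → ℝ) :
    expectation (mixture p ρ) f = expectation p fun x => expectation (ρ x) f := by
  change ∑ y, (∑ x, p x * ρ x y) * f y = ∑ x, p x * ∑ y, ρ x y * f y
  simp only [Finset.sum_mul, Finset.mul_sum, mul_assoc]
  exact Finset.sum_comm

theorem mixture_const (p : stdSimplex ℝ X) (q : stdSimplex ℝ Y) : mixture p (fun _ => q) = q :=
  stdSimplex_ext_expectation fun f => by rw [expectation_mixture, expectation_const]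

theorem mixture_pointMass (p : stdSimplex ℝ X) : mixture p pointMass = p :=
  stdSimplex_ext_expectation fun f => by simp only [expectation_mixture, expectation_pointMass]

end Expectation

/-! ### Nonlinear expectations and Bellman equations -/

section Bellman

variable {X : Type}

/-- A monotone, translation-equivariant functional. The infimum of the expectations under a
set of distributions is the main example; these are the functionals whose discounted Bellman
equations are well-posed. -/
structure IsNonlinearExpectation (E : (X → ℝ) → ℝ) : Prop where
  mono : Monotone E
  add_const : ∀ (f : X → ℝ) (a : ℝ), E (fun x => f x + a) = E f + a

theorem isNonlinearExpectation_expectation [Fintype X] (p : stdSimplex ℝ X) :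
    IsNonlinearExpectation (expectation p) where
  mono := expectation_mono p
  add_const f a := by rw [expectation_add, expectation_const]

theorem isNonlinearExpectation_eval (x : X) : IsNonlinearExpectation fun V => V x where
  mono _ _ h := h x
  add_const _ _ := rfl

theorem IsNonlinearExpectation.comp {Y : Type} {E : (X → ℝ) → ℝ} {D : X → (Y → ℝ) → ℝ}
    (hE : IsNonlinearExpectation E) (hD : ∀ x, IsNonlinearExpectation (D x)) :
    IsNonlinearExpectation fun V => E fun x => D x V where
  mono _ _ h := hE.mono fun x => (hD x).mono h
  add_const V a := by simp only [(hD _).add_const, hE.add_const]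

theorem IsNonlinearExpectation.le_add_of_le_add {E : (X → ℝ) → ℝ}
    (hE : IsNonlinearExpectation E) {f g : X → ℝ} {a : ℝ} (h : ∀ x, f x ≤ g x + a) :
    E f ≤ E g + a :=
  (hE.mono h).trans_eq (hE.add_const g a)

theorem IsNonlinearExpectation.dist_le [Fintype X] {E : (X → ℝ) → ℝ}
    (hE : IsNonlinearExpectation E) (f g : X → ℝ) : dist (E f) (E g) ≤ dist f g := by
  have one_sided : ∀ f g : X → ℝ, E f ≤ E g + dist f g := fun f g =>
    hE.le_add_of_le_add fun x => by
      linarith [Real.dist_eq (f x) (g x) ▸ dist_le_pi_dist f g x, le_abs_self (f x - g x)]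
  rw [Real.dist_eq, abs_sub_le_iff]
  constructor
  · linarith [one_sided f g]
  · linarith [one_sided g f, dist_comm f g]

/-- `V` solves the Bellman equation `V(x) = c(x) + γ 𝓔ₓ[V]` with rewards `c`, discount factor `γ`
and one-step (nonlinear) expectations `𝓔ₓ`. -/
def IsBellmanSolution (c : X → ℝ) (γ : ℝ) (E : X → (X → ℝ) → ℝ) (V : X → ℝ) : Prop :=
  ∀ x, V x = c x + γ * E x V

variable {c : X → ℝ} {γ : ℝ} {E : X → (X → ℝ) → ℝ}

theorem exists_isBellmanSolution [Finite X] (c : X → ℝ) (hγ : 0 ≤ γ) (hγ1 : γ < 1)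
    (hE : ∀ x, IsNonlinearExpectation (E x)) : ∃ V, IsBellmanSolution c γ E V := by
  have := Fintype.ofFinite X
  let T : (X → ℝ) → X → ℝ := fun V x => c x + γ * E x V
  have hT : ContractingWith ⟨γ, hγ⟩ T := by
    refine ⟨hγ1, LipschitzWith.of_dist_le_mul fun V W => ?_⟩
    refine (dist_pi_le_iff (by positivity)).2 fun x => ?_
    rw [dist_add_left, Real.dist_eq, ← mul_sub, abs_mul, abs_of_nonneg hγ, ← Real.dist_eq]
    exact mul_le_mul_of_nonneg_left ((hE x).dist_le V W) hγ
  exact ⟨hT.fixedPoint T, fun x => (congrFun hT.fixedPoint_isFixedPt x).symm⟩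

theorem subsolution_le_supersolution [Finite X] (hγ : 0 ≤ γ) (hγ1 : γ < 1)
    (hE : ∀ x, IsNonlinearExpectation (E x)) {V W : X → ℝ} (hV : ∀ x, V x ≤ c x + γ * E x V)
    (hW : ∀ x, c x + γ * E x W ≤ W x) : V ≤ W := by
  intro x
  have : Nonempty X := ⟨x⟩
  obtain ⟨z, hz⟩ := Finite.exists_max fun x => V x - W x
  have hEz : E z V ≤ E z W + (V z - W z) :=
    (hE z).le_add_of_le_add fun x => by linarith [hz x]
  have hmax : V z - W z ≤ γ * (V z - W z) := by
    linarith [hV z, hW z, mul_le_mul_of_nonneg_left hEz hγ]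
  have hmax_nonpos : V z - W z ≤ 0 := by nlinarith
  linarith [hz x]

theorem IsBellmanSolution.mono [Finite X] {E' : X → (X → ℝ) → ℝ} (hγ : 0 ≤ γ) (hγ1 : γ < 1)
    (hE' : ∀ x, IsNonlinearExpectation (E' x)) (hle : ∀ x V, E x V ≤ E' x V) {V W : X → ℝ}
    (hV : IsBellmanSolution c γ E V) (hW : IsBellmanSolution c γ E' W) : V ≤ W :=
  subsolution_le_supersolution hγ hγ1 hE'
    (fun x => (hV x).trans_le (by gcongr; exact hle x V)) fun x => (hW x).ge

theorem isBellmanSolution_of_forall_eq (hγ1 : γ < 1) (hE : ∀ x, IsNonlinearExpectation (E x))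
    {κ : ℝ} (hκ : ∀ x, E x c = κ) :
    IsBellmanSolution c γ E fun x => c x + γ * (1 - γ)⁻¹ * κ := by
  intro x
  have h : 1 - γ ≠ 0 := by linarith
  rw [(hE x).add_const, hκ]
  field_simp
  ring

end Bellman

/-! ### Discounted rewards of finite Markov chains -/

section Chain

theorem tendsto_pow_mul_integral_comp {Ω X : Type} [MeasurableSpace Ω] [Finite X] (μ : Measure Ω)
    [IsProbabilityMeasure μ] (f : X → ℝ) (g : ℕ → Ω → X) {γ : ℝ} (hγ : 0 ≤ γ) (hγ1 : γ < 1) :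
    Filter.Tendsto (fun t => γ ^ t * ∫ ω, f (g t ω) ∂μ) Filter.atTop (nhds 0) := by
  have := Fintype.ofFinite X
  refine squeeze_zero_norm (a := fun t => γ ^ t * ‖f‖) (fun t => ?_) ?_
  · have hbound : ‖∫ ω, f (g t ω) ∂μ‖ ≤ ‖f‖ := by
      simpa using norm_integral_le_of_norm_le_const (μ := μ)
        (Filter.Eventually.of_forall fun ω => norm_le_pi_norm f (g t ω))
    rw [norm_mul, Real.norm_of_nonneg (pow_nonneg hγ t)]
    exact mul_le_mul_of_nonneg_left hbound (pow_nonneg hγ t)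
  · simpa using (tendsto_pow_atTop_nhds_zero_of_lt_one hγ hγ1).mul_const ‖f‖

section Finite

variable {X : Type} [Finite X] [MeasurableSpace X] [DiscreteMeasurableSpace X]

theorem integrable_comp_of_finite {Ω : Type} [MeasurableSpace Ω] {μ : Measure Ω}
    [IsFiniteMeasure μ] (f : X → ℝ) {g : Ω → X} (hg : Measurable g) :
    Integrable (fun ω => f (g ω)) μ :=
  have := Fintype.ofFinite X
  Integrable.of_bound (C := ‖f‖)
    ((measurable_of_countable f).comp hg).aestronglyMeasurable
    (Filter.Eventually.of_forall fun ω => norm_le_pi_norm f (g ω))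

theorem hasSum_integral_discounted (μ : Measure (ℕ → X)) [IsProbabilityMeasure μ] (c : X → ℝ)
    {γ : ℝ} (hγ : 0 ≤ γ) (hγ1 : γ < 1) :
    HasSum (fun t => γ ^ t * ∫ ω, c (ω t) ∂μ) (∫ ω, ∑' t : ℕ, γ ^ t * c (ω t) ∂μ) := by
  have := Fintype.ofFinite X
  have hint : ∀ t, Integrable (fun ω => c (ω t)) μ := fun t =>
    integrable_comp_of_finite c (measurable_pi_apply t)
  simp only [← integral_const_mul]
  refine hasSum_integral_of_summable_integral_norm (fun t => (hint t).const_mul _) ?_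
  refine Summable.of_nonneg_of_le (fun t => by positivity) (fun t => ?_)
    ((summable_geometric_of_lt_one hγ hγ1).mul_right ‖c‖)
  have hbound : ∀ ω : ℕ → X, ‖γ ^ t * c (ω t)‖ ≤ γ ^ t * ‖c‖ := fun ω => by
    rw [norm_mul, Real.norm_of_nonneg (pow_nonneg hγ t)]
    exact mul_le_mul_of_nonneg_left (norm_le_pi_norm c _) (pow_nonneg hγ t)
  simpa using integral_mono ((hint t).const_mul (γ ^ t)).norm (integrable_const _) hbound

end Finite

variable {X : Type} [Fintype X] [MeasurableSpace X] [DiscreteMeasurableSpace X]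

theorem integral_simplexMeasure (p : stdSimplex ℝ X) (f : X → ℝ) :
    ∫ x, f x ∂(simplexMeasure p) = expectation p f := by
  have hsm : StronglyMeasurable f := (measurable_of_countable f).stronglyMeasurable
  rw [simplexMeasure, integral_finsetSum_measure]
  · refine Finset.sum_congr rfl fun x _ => ?_
    have hp : (ENNReal.ofReal (p x)).toReal = p x := ENNReal.toReal_ofReal (p.2.1 x)
    rw [integral_smul_measure, integral_dirac' f x hsm, hp, smul_eq_mul]
  · intro x _
    exact (integrable_dirac' hsm (by simp)).smul_measure ENNReal.ofReal_ne_top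

instance chainLaw_isProbabilityMeasure (q : stdSimplex ℝ X) (K : X → stdSimplex ℝ X) :
    IsProbabilityMeasure (chainLaw q K) := by
  unfold chainLaw
  infer_instance

theorem map_eval_zero_chainLaw (q : stdSimplex ℝ X) (K : X → stdSimplex ℝ X) :
    (chainLaw q K).map (fun ω => ω 0) = simplexMeasure q := by
  unfold chainLaw Kernel.trajMeasure
  have h0 : (fun ω : ℕ → X => ω 0) =
    (fun z : ((i : Finset.Iic 0) → X) => z ⟨0, by simp⟩) ∘ Preorder.frestrictLe 0 := rfl
  rw [h0, ← Measure.map_map (by fun_prop) (by fun_prop), Measure.map_comp _ _ (by fun_prop),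
    Kernel.traj_map_frestrictLe, Kernel.partialTraj_self, Measure.id_comp,
    Measure.map_map (by fun_prop) (by fun_prop)]
  convert! Measure.map_id

theorem integral_chainLaw_zero (q : stdSimplex ℝ X) (K : X → stdSimplex ℝ X) (f : X → ℝ) :
    ∫ ω, f (ω 0) ∂(chainLaw q K) = expectation q f := by
  rw [← integral_simplexMeasure, ← map_eval_zero_chainLaw q K,
    integral_map (measurable_pi_apply 0).aemeasurable
      (measurable_of_countable f).aestronglyMeasurable]

theorem integral_chainLaw_succ (q : stdSimplex ℝ X) (K : X → stdSimplex ℝ X) (f : X → ℝ) (t : ℕ) :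
    ∫ ω, f (ω (t + 1)) ∂(chainLaw q K) = ∫ ω, expectation (K (ω t)) f ∂(chainLaw q K) := by
  let κ : (t : ℕ) → Kernel ((i : Finset.Iic t) → X) X := fun t =>
    (stepKernel K).comap (fun ω => ω ⟨t, Finset.mem_Iic.2 le_rfl⟩) (measurable_pi_apply _)
  let past : (ℕ → X) → (i : Finset.Iic t) → X := Preorder.frestrictLe t
  have hpast : Measurable past := Preorder.measurable_frestrictLe t
  have markov : (chainLaw q K).map past ⊗ₘ κ t =
      (chainLaw q K).map fun ω => (past ω, ω (t + 1)) :=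
    Kernel.map_frestrictLe_trajMeasure_compProd_eq_map_trajMeasure
      (X := fun _ => X) (μ₀ := simplexMeasure q) (κ := κ) (a := t)
  have : IsProbabilityMeasure ((chainLaw q K).map past) :=
    Measure.isProbabilityMeasure_map hpast.aemeasurable
  have hf : Measurable f := measurable_of_countable f
  have hκ : ∀ z, ∫ y, f y ∂(κ t z) = expectation (K (z ⟨t, Finset.mem_Iic.2 le_rfl⟩)) f :=
    fun z => integral_simplexMeasure _ f
  calc ∫ ω, f (ω (t + 1)) ∂(chainLaw q K)
      = ∫ z, f z.2 ∂((chainLaw q K).map fun ω => (past ω, ω (t + 1))) :=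
        (integral_map (hpast.prodMk (measurable_pi_apply _)).aemeasurable
          (hf.comp measurable_snd).aestronglyMeasurable).symm
    _ = ∫ z, ∫ y, f y ∂(κ t z) ∂((chainLaw q K).map past) := by
        rw [← markov, Measure.integral_compProd (integrable_comp_of_finite f measurable_snd)]
    _ = ∫ ω, expectation (K (ω t)) f ∂(chainLaw q K) := by
        simp only [hκ]
        exact integral_map hpast.aemeasurable ((measurable_of_countable
          (fun x => expectation (K x) f)).comp (measurable_pi_apply _)).aestronglyMeasurable

end Chain

/-- The Bellman equation turns the discounted expected rewards into a telescoping series. -/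
theorem expectedTotalReward_eq_expectation {X : Type} [Fintype X] {q : stdSimplex ℝ X}
    {K : X → stdSimplex ℝ X} {c V : X → ℝ} {γ : ℝ} (hγ : 0 ≤ γ) (hγ1 : γ < 1)
    (hV : IsBellmanSolution c γ (fun x => expectation (K x)) V) :
    expectedTotalReward q K c γ = expectation q V := by
  let _ : MeasurableSpace X := ⊤
  let μ := chainLaw q K
  have hstep : ∀ t, γ ^ t * ∫ ω, c (ω t) ∂μ =
      γ ^ t * ∫ ω, V (ω t) ∂μ - γ ^ (t + 1) * ∫ ω, V (ω (t + 1)) ∂μ := by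
    intro t
    have hint : ∀ f : X → ℝ, Integrable (fun ω => f (ω t)) μ := fun f =>
      integrable_comp_of_finite f (measurable_pi_apply t)
    have hVt : ∫ ω, V (ω t) ∂μ = ∫ ω, c (ω t) ∂μ + γ * ∫ ω, V (ω (t + 1)) ∂μ := by
      rw [integral_chainLaw_succ, ← integral_const_mul, ← integral_add (hint c)
        ((hint fun x => expectation (K x) V).const_mul γ)]
      exact integral_congr_ae (Filter.Eventually.of_forall fun ω => hV (ω t))
    rw [hVt]
    ring
  have hsum := (hasSum_integral_discounted μ c hγ hγ1).tendsto_sum_nat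
  simp only [hstep, Finset.sum_range_sub', pow_zero, one_mul] at hsum
  refine tendsto_nhds_unique hsum ?_
  rw [show expectation q V = ∫ ω, V (ω 0) ∂μ from (integral_chainLaw_zero q K V).symm]
  simpa using tendsto_const_nhds.sub (tendsto_pow_mul_integral_comp μ V (fun t ω => ω t) hγ hγ1)

/-! ### Lower expectations -/

section LowerExpectation

variable {X Y : Type} [Fintype X] [Fintype Y]

/-- The lower expectation `inf {𝔼ₚ[f] | p ∈ C}` over an ambiguity set `C ⊆ Δ(X)`. -/
def lowerExpectation (C : Set (stdSimplex ℝ X)) (f : X → ℝ) : ℝ := ⨅ p : C, expectation p.1 f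

variable {C D : Set (stdSimplex ℝ X)} {f g : X → ℝ} {a : ℝ}

theorem lowerExpectation_le {p : stdSimplex ℝ X} (hp : p ∈ C) :
    lowerExpectation C f ≤ expectation p f := by
  refine ciInf_le ⟨-‖f‖, ?_⟩ (⟨p, hp⟩ : C)
  rintro _ ⟨q, rfl⟩
  rw [← expectation_const q.1 (-‖f‖)]
  exact expectation_mono q.1 fun x => (abs_le.1 (norm_le_pi_norm f x)).1

theorem le_lowerExpectation (hC : C.Nonempty) (h : ∀ p ∈ C, a ≤ expectation p f) :
    a ≤ lowerExpectation C f :=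
  have := hC.to_subtype
  le_ciInf fun p : C => h p p.2

theorem exists_expectation_lt_of_lowerExpectation_lt (hC : C.Nonempty)
    (h : lowerExpectation C f < a) : ∃ p ∈ C, expectation p f < a :=
  have := hC.to_subtype
  let ⟨p, hp⟩ := exists_lt_of_ciInf_lt h
  ⟨p, p.2, hp⟩

theorem lowerExpectation_anti (hC : C.Nonempty) (h : C ⊆ D) :
    lowerExpectation D f ≤ lowerExpectation C f :=
  le_lowerExpectation hC fun _ hp => lowerExpectation_le (h hp)

theorem lowerExpectation_singleton (p : stdSimplex ℝ X) :
    lowerExpectation {p} f = expectation p f :=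
  ciInf_unique

theorem isNonlinearExpectation_lowerExpectation (hC : C.Nonempty) :
    IsNonlinearExpectation (lowerExpectation C) where
  mono _ _ h := le_lowerExpectation hC fun p hp =>
    (lowerExpectation_le hp).trans (expectation_mono p h)
  add_const f a := by
    refine le_antisymm ?_ (le_lowerExpectation hC fun p hp => ?_)
    · rw [← sub_le_iff_le_add]
      refine le_lowerExpectation hC fun p hp => ?_
      rw [sub_le_iff_le_add, ← (isNonlinearExpectation_expectation p).add_const]
      exact lowerExpectation_le hp
    · rw [(isNonlinearExpectation_expectation p).add_const]
      gcongr
      exact lowerExpectation_le hp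

theorem lowerExpectation_nonneg (hf : ∀ x, 0 ≤ f x) : 0 ≤ lowerExpectation C f :=
  Real.iInf_nonneg fun p => (expectation_const p.1 0).ge.trans (expectation_mono p.1 hf)

theorem lowerExpectation_eq_of_forall_eq (hC : C.Nonempty) (h : ∀ p ∈ C, expectation p f = a) :
    lowerExpectation C f = a := by
  obtain ⟨p, hp⟩ := hC
  exact le_antisymm ((lowerExpectation_le hp).trans_eq (h p hp))
    (le_lowerExpectation ⟨p, hp⟩ fun q hq => (h q hq).ge)

theorem lowerExpectation_univ_eq_of_forall_le {x : X} (h : ∀ y, f x ≤ f y) :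
    lowerExpectation Set.univ f = f x := by
  refine le_antisymm ?_ (le_lowerExpectation ⟨pointMass x, trivial⟩ fun p _ => ?_)
  · exact (lowerExpectation_le (Set.mem_univ (pointMass x))).trans_eq (expectation_pointMass x f)
  · exact (expectation_const p (f x)).ge.trans (expectation_mono p h)

theorem lowerExpectation_const_mul (C : Set (stdSimplex ℝ X)) (ha : 0 ≤ a) (f : X → ℝ) :
    lowerExpectation C (fun x => a * f x) = a * lowerExpectation C f := by
  simp only [lowerExpectation, expectation_const_mul, Real.mul_iInf_of_nonneg ha]

theorem lowerExpectation_image_mixture (C : Set (stdSimplex ℝ X)) (ρ : X → stdSimplex ℝ Y)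
    (f : Y → ℝ) : lowerExpectation ((fun p => mixture p ρ) '' C) f =
      lowerExpectation C fun x => expectation (ρ x) f := by
  rw [lowerExpectation, ← sInf_image' (f := fun p => expectation p f), Set.image_image]
  simp only [expectation_mixture]
  exact sInf_image' (f := fun p => expectation p fun x => expectation (ρ x) f)

theorem mixture_mem_of_convex {C : Set (stdSimplex ℝ Y)} (hC : Convex ℝ (Subtype.val '' C))
    (p : stdSimplex ℝ X) {ρ : X → stdSimplex ℝ Y} (hρ : ∀ x, ρ x ∈ C) : mixture p ρ ∈ C := by
  have hmix : (mixture p ρ).1 = ∑ x, p x • (ρ x).1 := by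
    ext y
    simp only [Finset.sum_apply, Pi.smul_apply, smul_eq_mul]
    rfl
  have hmem : (mixture p ρ).1 ∈ Subtype.val '' C :=
    hmix ▸ hC.sum_mem (fun x _ => p.2.1 x) p.2.2 fun x _ => Set.mem_image_of_mem _ (hρ x)
  exact Subtype.val_injective.mem_set_image.1 hmem

end LowerExpectation

/-! ### Marginals, product distributions and couplings -/

section Couplings

variable {ι : Type} [Fintype ι] [DecidableEq ι] {S : ι → Type} [∀ i, Fintype (S i)]

theorem sum_marg_mul (p : stdSimplex ℝ (∀ i, S i)) (i : ι) (g : S i → ℝ) :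
    ∑ σ, marg p i σ * g σ = expectation p fun s => g (s i) := by
  classical
  simp only [marg, Finset.sum_mul, ite_mul, zero_mul]
  rw [Finset.sum_comm]
  refine Finset.sum_congr rfl fun s _ => ?_
  rw [Finset.sum_ite_eq, if_pos (Finset.mem_univ _)]

/-- The marginal `marg p i` as an element of `Δ(S i)`. -/
def marginal (p : stdSimplex ℝ (∀ i, S i)) (i : ι) : stdSimplex ℝ (S i) :=
  ⟨marg p i, fun σ => Finset.sum_nonneg fun s _ => by split_ifs; exacts [p.2.1 s, le_rfl], by
    simpa only [mul_one, expectation_const] using sum_marg_mul p i fun _ => 1⟩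

theorem expectation_marginal (p : stdSimplex ℝ (∀ i, S i)) (i : ι) (g : S i → ℝ) :
    expectation (marginal p i) g = expectation p fun s => g (s i) :=
  sum_marg_mul p i g

theorem marginal_mixture {X : Type} [Fintype X] (p : stdSimplex ℝ X)
    (ρ : X → stdSimplex ℝ (∀ i, S i)) (i : ι) :
    marginal (mixture p ρ) i = mixture p fun x => marginal (ρ x) i :=
  stdSimplex_ext_expectation fun f => by simp only [expectation_marginal, expectation_mixture]

theorem marginal_pointMass (u : ∀ i, S i) (i : ι) :
    marginal (pointMass u) i = pointMass (u i) :=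
  stdSimplex_ext_expectation fun f => by simp only [expectation_marginal, expectation_pointMass]

theorem apply_eq_of_marginal_eq_pointMass {p : stdSimplex ℝ (∀ i, S i)} {i : ι} {σ : S i}
    (h : marginal p i = pointMass σ) {s : ∀ i, S i} (hs : p s ≠ 0) : s i = σ := by
  have : ∀ i, DecidableEq (S i) := fun _ => Classical.decEq _
  by_contra hne
  refine hs (le_antisymm ?_ (p.2.1 s))
  calc p s = expectation p (Pi.single s 1) := (expectation_pi_single p s).symm
    _ ≤ expectation p fun s' => if s' i = σ then 0 else 1 := by
        refine expectation_mono p fun s' => ?_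
        rcases eq_or_ne s' s with rfl | hs'
        · simp [hne]
        · simpa [hs'] using ite_nonneg le_rfl zero_le_one
    _ = 0 := by rw [← expectation_marginal p i fun τ => if τ = σ then 0 else 1, h,
          expectation_pointMass, if_pos rfl]

theorem expectation_productDistribution_prod (q : ∀ i, stdSimplex ℝ (S i)) (f : ∀ i, S i → ℝ) :
    expectation (productDistribution q) (fun s => ∏ i, f i (s i)) =
      ∏ i, expectation (q i) (f i) := by
  simp only [expectation, Fintype.prod_sum, Finset.prod_mul_distrib]
  rfl

theorem marginal_productDistribution (q : ∀ i, stdSimplex ℝ (S i)) (i : ι) :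
    marginal (productDistribution q) i = q i := by
  refine stdSimplex_ext_expectation fun f => ?_
  have h := expectation_productDistribution_prod q (Function.update (fun _ _ => 1) i f)
  rw [Finset.prod_eq_single i (fun j _ hj => by
    rw [Function.update_of_ne hj, expectation_const]) (by simp), Function.update_self] at h
  rw [expectation_marginal, ← h]
  congr 1
  ext s
  rw [Finset.prod_eq_single i (fun j _ hj => by rw [Function.update_of_ne hj]) (by simp),
    Function.update_self]

theorem productDistribution_pointMass (u : ∀ i, S i) :
    productDistribution (fun i => pointMass (u i)) = pointMass u := by
  have : ∀ i, DecidableEq (S i) := fun _ => Classical.decEq _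
  refine Subtype.ext (funext fun s => ?_)
  change ∏ i, pointMass (u i) (s i) = pointMass u s
  simp [pointMass_apply, Finset.prod_ite_zero, funext_iff]

theorem productDistribution_update_apply (q : ∀ i, stdSimplex ℝ (S i)) (k : ι)
    (μ : stdSimplex ℝ (S k)) (s : ∀ i, S i) :
    productDistribution (Function.update q k μ) s =
      μ (s k) * ∏ i ∈ Finset.univ \ {k}, q i (s i) := by
  rw [← Finset.prod_update_of_mem (Finset.mem_univ k)]
  exact Finset.prod_congr rfl fun i _ =>
    Function.apply_update (fun i (p : stdSimplex ℝ (S i)) => p (s i)) q k μ i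

theorem productDistribution_update (q : ∀ i, stdSimplex ℝ (S i)) (k : ι)
    (μ : stdSimplex ℝ (S k)) : productDistribution (Function.update q k μ) =
      mixture μ fun σ => productDistribution (Function.update q k (pointMass σ)) := by
  refine Subtype.ext (funext fun s => ?_)
  change productDistribution _ s = expectation μ fun σ => productDistribution _ s
  simp only [productDistribution_update_apply, mul_comm _ (∏ _ ∈ _, _), expectation_const_mul]
  congr 1
  exact congrArg (fun p : stdSimplex ℝ (S k) => p (s k)) (mixture_pointMass μ).symm

/-- The distributions whose `i`-th marginal belongs to `C i` for all `i`. -/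
def couplings (C : ∀ i, Set (stdSimplex ℝ (S i))) : Set (stdSimplex ℝ (∀ i, S i)) :=
  {p | ∀ i, marginal p i ∈ C i}

/-- The product distributions whose `i`-th factor belongs to `C i` for all `i`. -/
def products (C : ∀ i, Set (stdSimplex ℝ (S i))) : Set (stdSimplex ℝ (∀ i, S i)) :=
  productDistribution '' Set.univ.pi C

variable {C : ∀ i, Set (stdSimplex ℝ (S i))}

theorem products_nonempty (hC : ∀ i, (C i).Nonempty) : (products C).Nonempty :=
  (Set.univ_pi_nonempty_iff.2 hC).image _

theorem products_subset_couplings : products C ⊆ couplings C := by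
  rintro _ ⟨q, hq, rfl⟩ i
  rw [marginal_productDistribution]
  exact hq i trivial

theorem couplings_nonempty (hC : ∀ i, (C i).Nonempty) : (couplings C).Nonempty :=
  (products_nonempty hC).mono products_subset_couplings

theorem couplings_eq_image_of_forall_ne {k : ι} {u : ∀ i, S i}
    (hC : ∀ i ≠ k, C i = {pointMass (u i)}) :
    couplings C = (fun μ => mixture μ fun σ => pointMass (Function.update u k σ)) '' C k := by
  ext p
  constructor
  · refine fun hp => ⟨marginal p k, hp k, stdSimplex_ext_expectation fun f => ?_⟩
    have hsupp : ∀ s, p s ≠ 0 → f (Function.update u k (s k)) = f s := fun s hs => by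
      congr 1
      refine Function.update_eq_iff.2 ⟨rfl, fun i hi => ?_⟩
      have hmarg := hp i
      rw [hC i hi] at hmarg
      exact (apply_eq_of_marginal_eq_pointMass hmarg hs).symm
    simp only [expectation_mixture, expectation_pointMass]
    rw [expectation_marginal p k fun σ => f (Function.update u k σ)]
    exact le_antisymm (expectation_le_expectation fun s hs => (hsupp s hs).le)
      (expectation_le_expectation fun s hs => (hsupp s hs).ge)
  · rintro ⟨μ, hμ, rfl⟩ i
    simp only [marginal_mixture, marginal_pointMass]
    rcases eq_or_ne i k with rfl | hi
    · simpa only [Function.update_self, mixture_pointMass] using hμ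
    · simp only [Function.update_of_ne hi, mixture_const, hC i hi, Set.mem_singleton_iff]

theorem lowerExpectation_couplings_of_forall_ne {k : ι} {u : ∀ i, S i}
    (hC : ∀ i ≠ k, C i = {pointMass (u i)}) (V : (∀ i, S i) → ℝ) :
    lowerExpectation (couplings C) V =
      lowerExpectation (C k) fun σ => V (Function.update u k σ) := by
  rw [couplings_eq_image_of_forall_ne hC, lowerExpectation_image_mixture]
  simp only [expectation_pointMass]

theorem lowerExpectation_couplings_le_comonotone {X : Type} [Fintype X]
    {C : ι → Set (stdSimplex ℝ X)} {μ : stdSimplex ℝ X} (hμ : ∀ i, μ ∈ C i) (f : (ι → X) → ℝ) :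
    lowerExpectation (couplings C) f ≤ expectation μ fun x => f fun _ => x := by
  have hmem : mixture μ (fun x => pointMass fun _ => x) ∈ couplings C := fun i => by
    simpa only [marginal_mixture, marginal_pointMass, mixture_pointMass] using hμ i
  simpa only [expectation_mixture, expectation_pointMass] using
    lowerExpectation_le (f := f) hmem

/-- Drawing the `k`-th component from `C k` and then a coupling with that component fixed yields
a coupling. -/
theorem lowerExpectation_couplings_le (hC : ∀ i, (C i).Nonempty)
    (hconv : ∀ i, Convex ℝ (Subtype.val '' C i)) (k : ι) (V : (∀ i, S i) → ℝ) :
    lowerExpectation (couplings C) V ≤ lowerExpectation (C k) fun σ =>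
      lowerExpectation (couplings (Function.update C k {pointMass σ})) V := by
  refine le_lowerExpectation (hC k) fun μ hμ => le_of_forall_pos_le_add fun ε hε => ?_
  have hne : ∀ σ, (couplings (Function.update C k {pointMass σ})).Nonempty := fun σ =>
    couplings_nonempty ((Function.forall_update_iff C fun i D => D.Nonempty).2
      ⟨Set.singleton_nonempty _, fun i _ => hC i⟩)
  choose ρ hρ hρlt using fun σ =>
    exists_expectation_lt_of_lowerExpectation_lt (f := V) (hne σ) (lt_add_of_pos_right _ hε)
  have hmix : mixture μ ρ ∈ couplings C := by
    intro i
    rw [marginal_mixture]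
    rcases eq_or_ne i k with rfl | hi
    · have hmarg : ∀ σ, marginal (ρ σ) i = pointMass σ := fun σ => by
        simpa only [Function.update_self, Set.mem_singleton_iff] using hρ σ i
      simpa only [hmarg, mixture_pointMass] using hμ
    · exact mixture_mem_of_convex (hconv i) μ fun σ => by
        simpa only [Function.update_of_ne hi] using hρ σ i
  calc lowerExpectation (couplings C) V
      ≤ expectation μ fun σ => expectation (ρ σ) V :=
        (lowerExpectation_le hmix).trans_eq (expectation_mixture μ ρ V)
    _ ≤ _ := (isNonlinearExpectation_expectation μ).le_add_of_le_add fun σ => (hρlt σ).le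

end Couplings

/-! ### Nested lower expectations -/

section Splice

variable {N : ℕ} {T : Fin N → Type}

/-- The family that agrees with `a` at the indices below `n` and with `b` at the others. -/
def splice (n : ℕ) (a b : ∀ i, T i) : ∀ i, T i := fun i => if i.val < n then a i else b i

theorem splice_zero (a b : ∀ i, T i) : splice 0 a b = b :=
  funext fun i => if_neg i.val.not_lt_zero

theorem splice_of_le {n : ℕ} (h : N ≤ n) (a b : ∀ i, T i) : splice n a b = a :=
  funext fun i => if_pos (i.isLt.trans_le h)

theorem splice_succ (k : Fin N) (a b : ∀ i, T i) :
    splice (k + 1) a b = Function.update (splice k a b) k (a k) := by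
  ext i
  rcases eq_or_ne i k with rfl | hi
  · simp [splice]
  · have hlt : i.val < k + 1 ↔ i.val < k := by
      have := Fin.val_ne_of_ne hi
      omega
    simp [splice, hi, hlt]

theorem splice_succ_update (k : Fin N) (a b : ∀ i, T i) (x : T k) :
    splice (k + 1) (Function.update a k x) b = Function.update (splice k a b) k x := by
  rw [splice_succ, Function.update_self]
  ext i
  rcases eq_or_ne i k with rfl | hi
  · simp
  · simp [splice, hi]

theorem update_splice_self (k : Fin N) (a b : ∀ i, T i) :
    Function.update (splice k a b) k (b k) = splice k a b :=
  Function.update_eq_self_iff.2 (if_neg (lt_irrefl _)).symm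

end Splice

section Nested

variable {N : ℕ} {S : Fin N → Type} [∀ i, Fintype (S i)]

/-- The lower expectation of `V` when nature redraws the components `n, n + 1, …, N - 1` of `u` one
after the other, the `i`-th from a distribution in `C i` that may depend on the earlier draws. -/
def nestedLowerExpectation (C : ∀ i, Set (stdSimplex ℝ (S i))) (V : (∀ i, S i) → ℝ) (n : ℕ)
    (u : ∀ i, S i) : ℝ :=
  if h : n < N then
    lowerExpectation (C ⟨n, h⟩) fun σ =>
      nestedLowerExpectation C V (n + 1) (Function.update u ⟨n, h⟩ σ)
  else V u
termination_by N - n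

variable {C D : ∀ i, Set (stdSimplex ℝ (S i))} {V : (∀ i, S i) → ℝ}

theorem nestedLowerExpectation_of_le {n : ℕ} (h : N ≤ n) (u : ∀ i, S i) :
    nestedLowerExpectation C V n u = V u := by
  rw [nestedLowerExpectation, dif_neg h.not_gt]

theorem nestedLowerExpectation_val (k : Fin N) (u : ∀ i, S i) :
    nestedLowerExpectation C V k u =
      lowerExpectation (C k) fun σ =>
        nestedLowerExpectation C V (k + 1) (Function.update u k σ) := by
  rw [nestedLowerExpectation, dif_pos k.isLt]

theorem nestedLowerExpectation_fin_three {X : Type} [Fintype X] {C : Fin 3 → Set (stdSimplex ℝ X)}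
    {V : (Fin 3 → X) → ℝ} (u : Fin 3 → X) :
    nestedLowerExpectation C V 0 u =
      lowerExpectation (C 0) fun σ₀ => lowerExpectation (C 1) fun σ₁ =>
        lowerExpectation (C 2) fun σ₂ => V ![σ₀, σ₁, σ₂] := by
  have hupdate : ∀ σ₀ σ₁ σ₂, Function.update (Function.update (Function.update u 0 σ₀) 1 σ₁) 2 σ₂ =
      ![σ₀, σ₁, σ₂] := fun σ₀ σ₁ σ₂ => by
    ext i
    fin_cases i <;> rfl
  have h0 := fun u => nestedLowerExpectation_val (C := C) (V := V) 0 u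
  have h1 := fun u => nestedLowerExpectation_val (C := C) (V := V) 1 u
  have h2 := fun u => nestedLowerExpectation_val (C := C) (V := V) 2 u
  simp only [Fin.val_zero, Fin.val_one, Fin.val_two, zero_add] at h0 h1 h2
  simp only [h0, h1, h2, nestedLowerExpectation_of_le le_rfl, hupdate]

theorem isNonlinearExpectation_nestedLowerExpectation (hC : ∀ i, (C i).Nonempty) (n : ℕ)
    (u : ∀ i, S i) : IsNonlinearExpectation fun V => nestedLowerExpectation C V n u := by
  induction n, u using nestedLowerExpectation.induct with
  | case1 n u h ih =>
    simp only [nestedLowerExpectation_val ⟨n, h⟩]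
    exact (isNonlinearExpectation_lowerExpectation (hC ⟨n, h⟩)).comp ih
  | case2 n u h =>
    simp only [nestedLowerExpectation_of_le (not_lt.1 h)]
    exact isNonlinearExpectation_eval u

theorem nestedLowerExpectation_anti (hC : ∀ i, (C i).Nonempty) (h : ∀ i, C i ⊆ D i) (n : ℕ)
    (u : ∀ i, S i) : nestedLowerExpectation D V n u ≤ nestedLowerExpectation C V n u := by
  fun_induction nestedLowerExpectation D V n u with
  | case1 n u hn ih =>
    rw [nestedLowerExpectation_val ⟨n, hn⟩]
    exact ((isNonlinearExpectation_lowerExpectation ((hC _).mono (h _))).mono ih).trans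
      (lowerExpectation_anti (hC _) (h _))
  | case2 n u hn => rw [nestedLowerExpectation_of_le (not_lt.1 hn)]

theorem nestedLowerExpectation_singleton (q : ∀ i, stdSimplex ℝ (S i)) (V : (∀ i, S i) → ℝ)
    (n : ℕ) (u : ∀ i, S i) :
    nestedLowerExpectation (fun i => {q i}) V n u =
      expectation (productDistribution (splice n (fun i => pointMass (u i)) q)) V := by
  fun_induction nestedLowerExpectation (fun i => {q i}) V n u with
  | case1 n u hn ih =>
    simp only [ih, lowerExpectation_singleton, ← expectation_mixture]
    rw [← update_splice_self ⟨n, hn⟩, productDistribution_update]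
    congr! 3 with σ
    rw [← splice_succ_update ⟨n, hn⟩]
    congr 2 with i : 1
    exact Function.apply_update (fun i (x : S i) => pointMass x) u _ σ i
  | case2 n u hn =>
    rw [splice_of_le (not_lt.1 hn), productDistribution_pointMass, expectation_pointMass]

theorem lowerExpectation_couplings_splice_le_nested (hC : ∀ i, (C i).Nonempty)
    (hconv : ∀ i, Convex ℝ (Subtype.val '' C i)) (V : (∀ i, S i) → ℝ) (n : ℕ) (u : ∀ i, S i) :
    lowerExpectation (couplings (splice n (fun i => {pointMass (u i)}) C)) V ≤
      nestedLowerExpectation C V n u := by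
  fun_induction nestedLowerExpectation C V n u with
  | case1 n u hn ih =>
    have hD : ∀ i, (splice n (fun i => {pointMass (u i)}) C i).Nonempty ∧
        Convex ℝ (Subtype.val '' splice n (fun i => {pointMass (u i)}) C i) := fun i => by
      unfold splice
      split
      · simp
      · exact ⟨hC i, hconv i⟩
    have hdraw :=
      lowerExpectation_couplings_le (fun i => (hD i).1) (fun i => (hD i).2) ⟨n, hn⟩ V
    have hk : splice n (fun i => {pointMass (u i)}) C ⟨n, hn⟩ = C ⟨n, hn⟩ := if_neg (lt_irrefl _)
    rw [hk] at hdraw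
    refine hdraw.trans ((isNonlinearExpectation_lowerExpectation (hC _)).mono fun σ => ?_)
    refine (ih σ).trans' (le_of_eq ?_)
    rw [← splice_succ_update ⟨n, hn⟩]
    congr 3 with i : 1
    exact (Function.apply_update (fun i (x : S i) => {pointMass x}) u _ σ i).symm
  | case2 n u hn =>
    rw [splice_of_le (not_lt.1 hn), ← expectation_pointMass u V]
    exact lowerExpectation_le fun i => marginal_pointMass u i

theorem lowerExpectation_couplings_le_nested (hC : ∀ i, (C i).Nonempty)
    (hconv : ∀ i, Convex ℝ (Subtype.val '' C i)) (V : (∀ i, S i) → ℝ) (u : ∀ i, S i) :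
    lowerExpectation (couplings C) V ≤ nestedLowerExpectation C V 0 u := by
  simpa only [splice_zero] using lowerExpectation_couplings_splice_le_nested hC hconv V 0 u

theorem nestedLowerExpectation_le_products (hC : ∀ i, (C i).Nonempty) (V : (∀ i, S i) → ℝ)
    (u : ∀ i, S i) : nestedLowerExpectation C V 0 u ≤ lowerExpectation (products C) V := by
  refine le_lowerExpectation (products_nonempty hC) ?_
  rintro _ ⟨q, hq, rfl⟩
  calc nestedLowerExpectation C V 0 u
      ≤ nestedLowerExpectation (fun i => {q i}) V 0 u :=
        nestedLowerExpectation_anti (fun _ => Set.singleton_nonempty _)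
          (fun i => Set.singleton_subset_iff.2 (hq i trivial)) 0 u
    _ = expectation (productDistribution q) V := by
        rw [nestedLowerExpectation_singleton, splice_zero]

/-- Nature keeps the invariant `I` alive by steering each draw into its support. -/
theorem nestedLowerExpectation_le_of_invariant {I : ℕ → (∀ i, S i) → Prop} {a : ℝ}
    (hlast : ∀ u, I N u → V u ≤ a)
    (hstep : ∀ (k : Fin N) u, I k u →
      ∃ p ∈ C k, ∀ σ, p σ ≠ 0 → I (k + 1) (Function.update u k σ))
    {n : ℕ} (hn : n ≤ N) {u : ∀ i, S i} (hu : I n u) : nestedLowerExpectation C V n u ≤ a := by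
  fun_induction nestedLowerExpectation C V n u with
  | case1 n u h ih =>
    obtain ⟨p, hp, hI⟩ := hstep ⟨n, h⟩ u hu
    calc lowerExpectation (C ⟨n, h⟩) _
        ≤ expectation p fun _ => a := (lowerExpectation_le hp).trans
          (expectation_le_expectation fun σ hσ => ih σ h (hI σ hσ))
      _ = a := expectation_const p a
  | case2 n u h => exact hlast u (le_antisymm hn (not_lt.1 h) ▸ hu)

end Nested

/-! ### The factored and non-factored objectives -/

theorem IsPolyhedron.convex {X : Type} [Fintype X] {C : Set (X → ℝ)} (hC : IsPolyhedron C) :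
    Convex ℝ C := by
  obtain ⟨m, G, h, rfl⟩ := hC
  exact (convex_Iic h).is_linear_preimage G.mulVecLin.isLinear

namespace RFMDP

section Objectives

variable {ι : Type} {S : ι → Type} [∀ i, Fintype (S i)] {A Φ : Type}

/-- The marginal ambiguity set `𝒫ⁱ(f)` as a subset of `Δ(S i)`. -/
def ambiguity (R : RFMDP S A Φ) (f : Φ) (i : ι) : Set (stdSimplex ℝ (S i)) :=
  Subtype.val ⁻¹' R.P i f

theorem ambiguity_nonempty (R : RFMDP S A Φ) (s : ∀ i, S i) (a : A) (i : ι) :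
    (R.ambiguity (R.φ s a) i).Nonempty :=
  let ⟨p, hp⟩ := R.P_nonempty i s a
  ⟨⟨p, R.P_subset i _ hp⟩, hp⟩

theorem convex_ambiguity (R : RFMDP S A Φ) (f : Φ) (i : ι) :
    Convex ℝ (Subtype.val '' R.ambiguity f i) := by
  rw [ambiguity, Subtype.image_preimage_coe, Set.inter_eq_right.2 (R.P_subset i f)]
  exact (R.P_polyhedral i f).convex

variable [Fintype ι] [DecidableEq ι]

/-- The kernels that choose the transition probabilities from `C f` at every attained feature
`f`, independently across features. -/
def rectangularSet (R : RFMDP S A Φ) (C : Φ → Set (stdSimplex ℝ (∀ i, S i))) :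
    Set (Φ → stdSimplex ℝ (∀ i, S i)) :=
  {p | ∀ s a, p (R.φ s a) ∈ C (R.φ s a)}

theorem nonFactoredSet_eq_rectangularSet (R : RFMDP S A Φ) :
    R.nonFactoredSet = R.rectangularSet fun f => couplings (R.ambiguity f) :=
  rfl

theorem factoredSet_eq_rectangularSet (R : RFMDP S A Φ) :
    R.factoredSet = R.rectangularSet fun f => products (R.ambiguity f) := by
  ext p
  refine forall₂_congr fun s a => ⟨?_, ?_⟩
  · rintro ⟨pm, hpm, hprod⟩
    exact ⟨fun i => ⟨pm i, R.P_subset i _ (hpm i)⟩, fun i _ => hpm i,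
      Subtype.ext (funext fun s' => (hprod s').symm)⟩
  · rintro ⟨q, hq, hprod⟩
    exact ⟨fun i => (q i).1, fun i => hq i trivial, fun s' => by rw [← hprod]; rfl⟩

variable {R : RFMDP S A Φ} {π : (∀ i, S i) → A} {C : Φ → Set (stdSimplex ℝ (∀ i, S i))}
  {V : (∀ i, S i) → ℝ}

theorem le_value_of_isBellmanSolution
    (hV : IsBellmanSolution (fun s => R.r (R.φ s (π s))) R.γ
      (fun s => lowerExpectation (C (R.φ s (π s)))) V)
    {p : Φ → stdSimplex ℝ (∀ i, S i)} (hp : p ∈ R.rectangularSet C) :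
    expectation (productDistribution R.q) V ≤ R.value π p := by
  have hE := fun s => isNonlinearExpectation_expectation (p (R.φ s (π s)))
  obtain ⟨W, hW⟩ :=
    exists_isBellmanSolution (fun s => R.r (R.φ s (π s))) R.γ_pos.le R.γ_lt_one hE
  rw [value, expectedTotalReward_eq_expectation R.γ_pos.le R.γ_lt_one hW]
  refine expectation_mono _ (subsolution_le_supersolution R.γ_pos.le R.γ_lt_one hE (fun s => ?_)
    fun s => (hW s).ge)
  exact (hV s).trans_le (add_le_add_right (mul_le_mul_of_nonneg_left
    (lowerExpectation_le (hp s (π s))) R.γ_pos.le) _)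

theorem exists_mem_rectangularSet_expectation_le (hC : ∀ s a, (C (R.φ s a)).Nonempty)
    (V : (∀ i, S i) → ℝ) {ε : ℝ} (hε : 0 < ε) :
    ∃ p ∈ R.rectangularSet C, ∀ s a, expectation (p (R.φ s a)) V ≤
      lowerExpectation (C (R.φ s a)) V + ε := by
  have hchoice : ∀ f, ∃ ρ, (C f).Nonempty →
      ρ ∈ C f ∧ expectation ρ V ≤ lowerExpectation (C f) V + ε := fun f => by
    by_cases hf : (C f).Nonempty
    · obtain ⟨ρ, hρ, hlt⟩ :=
        exists_expectation_lt_of_lowerExpectation_lt hf (lt_add_of_pos_right _ hε)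
      exact ⟨ρ, fun _ => ⟨hρ, hlt.le⟩⟩
    · exact ⟨productDistribution R.q, fun h => absurd h hf⟩
  choose p hp using hchoice
  exact ⟨p, fun s a => (hp _ (hC s a)).1, fun s a => (hp _ (hC s a)).2⟩

theorem exists_value_le_add (hC : ∀ s a, (C (R.φ s a)).Nonempty)
    (hV : IsBellmanSolution (fun s => R.r (R.φ s (π s))) R.γ
      (fun s => lowerExpectation (C (R.φ s (π s)))) V) {ε : ℝ} (hε : 0 < ε) :
    ∃ p ∈ R.rectangularSet C, R.value π p ≤ expectation (productDistribution R.q) V + ε := by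
  have hγ1 : 0 < 1 - R.γ := sub_pos.2 R.γ_lt_one
  obtain ⟨p, hp, hpV⟩ := exists_mem_rectangularSet_expectation_le hC V (mul_pos hγ1 hε)
  refine ⟨p, hp, ?_⟩
  have hE := fun s => isNonlinearExpectation_expectation (p (R.φ s (π s)))
  obtain ⟨W, hW⟩ :=
    exists_isBellmanSolution (fun s => R.r (R.φ s (π s))) R.γ_pos.le R.γ_lt_one hE
  rw [value, expectedTotalReward_eq_expectation R.γ_pos.le R.γ_lt_one hW]
  refine (isNonlinearExpectation_expectation _).le_add_of_le_add ?_
  refine subsolution_le_supersolution R.γ_pos.le R.γ_lt_one hE (fun s => (hW s).le) fun s => ?_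
  rw [(hE s).add_const]
  have hs := mul_le_mul_of_nonneg_left (hpV s (π s)) R.γ_pos.le
  -- `V + ε` is a supersolution because `γ((1 - γ)ε + ε) ≤ ε`, that is, `0 ≤ (1 - γ)² ε`.
  nlinarith [hV s, mul_nonneg (sq_nonneg (1 - R.γ)) hε.le]

theorem iInf_value_rectangularSet (hC : ∀ s a, (C (R.φ s a)).Nonempty)
    (hV : IsBellmanSolution (fun s => R.r (R.φ s (π s))) R.γ
      (fun s => lowerExpectation (C (R.φ s (π s)))) V) :
    ⨅ p : R.rectangularSet C, R.value π p = expectation (productDistribution R.q) V := by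
  obtain ⟨p₀, hp₀, -⟩ := exists_value_le_add hC hV one_pos
  have : Nonempty (R.rectangularSet C) := ⟨⟨p₀, hp₀⟩⟩
  refine le_antisymm (le_of_forall_pos_le_add fun ε hε => ?_)
    (le_ciInf fun p => le_value_of_isBellmanSolution hV p.2)
  obtain ⟨p, hp, hle⟩ := exists_value_le_add hC hV hε
  have hbdd : BddBelow (Set.range fun p : R.rectangularSet C => R.value π p) :=
    ⟨_, Set.forall_mem_range.2 fun p => le_value_of_isBellmanSolution hV p.2⟩
  exact (ciInf_le hbdd ⟨p, hp⟩).trans hle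

theorem NF_eq_expectation
    (hV : IsBellmanSolution (fun s => R.r (R.φ s (π s))) R.γ
      (fun s => lowerExpectation (couplings (R.ambiguity (R.φ s (π s))))) V) :
    R.NF π = expectation (productDistribution R.q) V := by
  rw [NF, nonFactoredSet_eq_rectangularSet]
  exact iInf_value_rectangularSet (C := fun f => couplings (R.ambiguity f))
    (fun s a => couplings_nonempty (R.ambiguity_nonempty s a)) hV

theorem F_eq_expectation
    (hV : IsBellmanSolution (fun s => R.r (R.φ s (π s))) R.γ
      (fun s => lowerExpectation (products (R.ambiguity (R.φ s (π s))))) V) :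
    R.F π = expectation (productDistribution R.q) V := by
  rw [F, factoredSet_eq_rectangularSet]
  exact iInf_value_rectangularSet (C := fun f => products (R.ambiguity f))
    (fun s a => products_nonempty (R.ambiguity_nonempty s a)) hV

end Objectives

end RFMDP

/-! ### The Bellman equation of the lift -/

theorem fin_add_one_eq_zero_iff {N : ℕ} [NeZero N] {n : Fin N} : n + 1 = 0 ↔ n.val + 1 = N := by
  rw [Fin.ext_iff, Fin.val_zero, Fin.val_add, Fin.coe_ofNat_eq_mod, Nat.add_mod_mod,
    ← Nat.dvd_iff_mod_eq_zero]
  exact ⟨fun h => le_antisymm n.isLt (Nat.le_of_dvd n.val.succ_pos h), fun h => h.symm.dvd⟩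

namespace RFMDP

section Lift

variable {N : ℕ} [NeZero N] {S : Fin N → Type} {A : Type}

/-- The successor of `x` under the action `b` if the active sub-state moves to `σ`. -/
def liftNext (s₀ : ∀ n, S n) (a₀ : A) (x : LiftState S A) (b : A) (σ : S x.n) : LiftState S A :=
  .mk (Function.update x.u x.n σ)
    (if x.n + 1 = 0 then s₀ else if x.n = 0 then x.u else x.m)
    (if x.n + 1 = 0 then a₀ else if x.n = 0 then b else x.a)
    (x.n + 1)

theorem liftNext_of_last {s₀ : ∀ n, S n} {a₀ : A} {x : LiftState S A} (h : x.n + 1 = 0) (b : A)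
    (σ : S x.n) : liftNext s₀ a₀ x b σ = .mk (Function.update x.u x.n σ) s₀ a₀ 0 := by
  rw [liftNext, if_pos h, if_pos h, h]

theorem liftNext_eq_update (s₀ : ∀ n, S n) (a₀ : A) (x : LiftState S A) (b : A) (τ σ : S x.n) :
    liftNext s₀ a₀ x b σ = Function.update (liftNext s₀ a₀ x b τ) (.upd x.n) σ := by
  refine Function.eq_update_iff.2 ⟨Function.update_self x.n σ x.u, fun i hi => ?_⟩
  match i with
  | .upd k =>
    have hk : k ≠ x.n := fun h => hi (congrArg LiftIdx.upd h)
    exact (Function.update_of_ne hk σ x.u).trans (Function.update_of_ne hk τ x.u).symm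
  | .mem _ | .act | .timer => rfl

variable [∀ n, Fintype (S n)] {Φ : Type}

/-- The feature that governs the transition of the lift out of `x` under the action `b`. -/
def activeFeature (R : RFMDP S A Φ) (x : LiftState S A) (b : A) : Φ :=
  if x.n = 0 then R.φ x.u b else R.φ x.m x.a

theorem activeFeature_liftNext (R : RFMDP S A Φ) {s₀ : ∀ n, S n} {a₀ : A} {x : LiftState S A}
    (h : x.n + 1 ≠ 0) (b b' : A) (σ : S x.n) :
    R.activeFeature (liftNext s₀ a₀ x b σ) b' = R.activeFeature x b := by
  have hfeature : R.activeFeature (liftNext s₀ a₀ x b σ) b' =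
      R.φ (if x.n = 0 then x.u else x.m) (if x.n = 0 then b else x.a) := by
    rw [activeFeature, if_neg (show (liftNext s₀ a₀ x b σ).n ≠ 0 from h)]
    change R.φ (if x.n + 1 = 0 then _ else _) (if x.n + 1 = 0 then _ else _) = _
    rw [if_neg h, if_neg h]
  rw [hfeature, activeFeature]
  split_ifs <;> rfl

variable [Fintype A] (R : RFMDP S A Φ) (s₀ : ∀ n, S n) (a₀ : A)

theorem lift_γ_pow : (R.lift s₀ a₀).γ ^ N = R.γ := by
  change (R.γ ^ (1 / (N : ℝ))) ^ N = R.γ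
  rw [← Real.rpow_natCast, ← Real.rpow_mul R.γ_pos.le, one_div,
    inv_mul_cancel₀ (Nat.cast_ne_zero.2 (NeZero.ne N)), Real.rpow_one]

theorem lift_ambiguity_active (x : LiftState S A) (b : A) :
    (R.lift s₀ a₀).ambiguity ((R.lift s₀ a₀).φ x b) (.upd x.n) =
      R.ambiguity (R.activeFeature x b) x.n := by
  change Subtype.val ⁻¹' R.updP x.n ((R.lift s₀ a₀).φ x b) = _
  unfold updP activeFeature lift
  simp only [if_true]
  rfl

theorem lift_ambiguity_of_ne {x : LiftState S A} {i : LiftIdx N} (hi : i ≠ .upd x.n) (b : A)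
    (σ : S x.n) : (R.lift s₀ a₀).ambiguity ((R.lift s₀ a₀).φ x b) i =
      {pointMass (liftNext s₀ a₀ x b σ i)} := by
  suffices hP : (R.lift s₀ a₀).P i ((R.lift s₀ a₀).φ x b) =
      {(pointMass (liftNext s₀ a₀ x b σ i)).1} by
    rw [ambiguity, hP, ← Set.image_singleton, Set.preimage_image_eq _ Subtype.val_injective]
  match i with
  | .upd k =>
    have hk : k ≠ x.n := fun h => hi (congrArg LiftIdx.upd h)
    have hu : liftNext s₀ a₀ x b σ (.upd k) = x.u k := Function.update_of_ne hk σ x.u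
    rw [hu]
    exact if_neg hk.symm
  | .mem k =>
    have hm : liftNext s₀ a₀ x b σ (.mem k) =
        if x.n + 1 = 0 then s₀ k else if x.n = 0 then x.u k else x.m k :=
      (ite_apply _ _ _ k).trans (congrArg (ite _ _) (ite_apply _ _ _ k))
    rw [hm]
    rfl
  | .act => rfl
  | .timer => rfl

theorem lowerExpectation_couplings_lift_ambiguity (x : LiftState S A) (b : A)
    (W : LiftState S A → ℝ) :
    lowerExpectation (couplings ((R.lift s₀ a₀).ambiguity ((R.lift s₀ a₀).φ x b))) W =
      lowerExpectation (R.ambiguity (R.activeFeature x b) x.n) fun σ =>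
        W (liftNext s₀ a₀ x b σ) := by
  rw [lowerExpectation_couplings_of_forall_ne fun i hi =>
    R.lift_ambiguity_of_ne s₀ a₀ hi b (x.u x.n), lift_ambiguity_active]
  congr 1
  ext σ
  rw [liftNext_eq_update s₀ a₀ x b (x.u x.n) σ]

theorem productDistribution_lift_q_mk (u : ∀ n, S n) :
    productDistribution (R.lift s₀ a₀).q (LiftState.mk u s₀ a₀ 0) = productDistribution R.q u := by
  refine (Fintype.prod_of_injective LiftIdx.upd (fun _ _ => LiftIdx.upd.inj) _ _ ?_
    fun _ => rfl).symm
  rintro (k | k | _ | _) hi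
  · exact absurd ⟨k, rfl⟩ hi
  all_goals exact if_pos rfl

theorem eq_mk_of_productDistribution_lift_q_ne_zero {x : LiftState S A}
    (hx : productDistribution (R.lift s₀ a₀).q x ≠ 0) : LiftState.mk x.u s₀ a₀ 0 = x := by
  have hfactor : ∀ i, R.liftq s₀ a₀ i (x i) ≠ 0 := fun i hi =>
    hx (Finset.prod_eq_zero (f := fun i => R.liftq s₀ a₀ i (x i)) (Finset.mem_univ i) hi)
  funext i
  have hi := hfactor i
  match i with
  | .upd k => rfl
  | .mem k => exact of_not_not fun hne => hi (if_neg (Ne.symm hne))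
  | .act => exact of_not_not fun hne => hi (if_neg (Ne.symm hne))
  | .timer => exact of_not_not fun hne => hi (if_neg (Ne.symm hne))

theorem expectation_productDistribution_lift_q (W : LiftState S A → ℝ) :
    expectation (productDistribution (R.lift s₀ a₀).q) W =
      expectation (productDistribution R.q) fun u => W (LiftState.mk u s₀ a₀ 0) := by
  have hinj : Function.Injective fun u : ∀ n, S n => (LiftState.mk u s₀ a₀ 0 : LiftState S A) :=
    fun _ _ h => congrArg LiftState.u h
  refine (Fintype.sum_of_injective _ hinj _ _ (fun x hx => ?_) fun u => ?_).symm
  · have hzero : productDistribution (R.lift s₀ a₀).q x = 0 := of_not_not fun h =>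
      hx ⟨x.u, R.eq_mk_of_productDistribution_lift_q_ne_zero s₀ a₀ h⟩
    rw [hzero, zero_mul]
  · rw [productDistribution_lift_q_mk]

/-- The value function of the lift: in the middle of a cycle, the remaining draws of the cycle are
evaluated by the nested lower expectation of the value function `V` at the start of the next
cycle. -/
def liftValue (πl : LiftState S A → A) (V : (∀ n, S n) → ℝ) (x : LiftState S A) : ℝ :=
  (R.lift s₀ a₀).r ((R.lift s₀ a₀).φ x (πl x)) + (R.lift s₀ a₀).γ ^ (N - x.n) *
    nestedLowerExpectation (R.ambiguity (R.activeFeature x (πl x))) V x.n x.u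

variable {R s₀ a₀} {π : (∀ n, S n) → A} {πl : LiftState S A → A} {V : (∀ n, S n) → ℝ}

theorem liftValue_mk (hπl : πl ∈ liftedPolicies s₀ a₀ π)
    (hV : IsBellmanSolution (fun u => R.r (R.φ u (π u))) R.γ
      (fun u W => nestedLowerExpectation (R.ambiguity (R.φ u (π u))) W 0 u) V) (u : ∀ n, S n) :
    R.liftValue s₀ a₀ πl V (LiftState.mk u s₀ a₀ 0) = V u := by
  have hr : (R.lift s₀ a₀).r ((R.lift s₀ a₀).φ (LiftState.mk u s₀ a₀ 0) (π u)) =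
      R.r (R.φ u (π u)) := if_pos ⟨rfl, rfl, rfl⟩
  have hactive : R.activeFeature (LiftState.mk u s₀ a₀ 0) (π u) = R.φ u (π u) := if_pos rfl
  have hzero : ((LiftState.mk u s₀ a₀ 0 : LiftState S A).n : ℕ) = 0 := Fin.val_zero N
  rw [liftValue, hπl, hr, hactive, hzero, Nat.sub_zero, lift_γ_pow]
  exact (hV u).symm

theorem liftValue_liftNext_of_not_last {x : LiftState S A} (h : x.n + 1 ≠ 0) (σ : S x.n) :
    R.liftValue s₀ a₀ πl V (liftNext s₀ a₀ x (πl x) σ) =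
      (R.lift s₀ a₀).γ ^ (N - (x.n + 1 : ℕ)) * nestedLowerExpectation
        (R.ambiguity (R.activeFeature x (πl x))) V (x.n + 1 : ℕ) (Function.update x.u x.n σ) := by
  have htimer : ((liftNext s₀ a₀ x (πl x) σ).n : ℕ) = x.n + 1 := by
    refine Fin.val_add_one_of_lt' (lt_of_le_of_ne x.n.isLt (mt fin_add_one_eq_zero_iff.2 h))
  have hr : (R.lift s₀ a₀).r ((R.lift s₀ a₀).φ (liftNext s₀ a₀ x (πl x) σ)
      (πl (liftNext s₀ a₀ x (πl x) σ))) = 0 := if_neg fun hx => h hx.2.2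
  rw [liftValue, hr, zero_add, activeFeature_liftNext _ h, htimer]
  rfl

theorem liftValue_liftNext (hπl : πl ∈ liftedPolicies s₀ a₀ π)
    (hV : IsBellmanSolution (fun u => R.r (R.φ u (π u))) R.γ
      (fun u W => nestedLowerExpectation (R.ambiguity (R.φ u (π u))) W 0 u) V)
    (x : LiftState S A) (σ : S x.n) :
    R.liftValue s₀ a₀ πl V (liftNext s₀ a₀ x (πl x) σ) =
      (R.lift s₀ a₀).γ ^ (N - (x.n + 1 : ℕ)) * nestedLowerExpectation
        (R.ambiguity (R.activeFeature x (πl x))) V (x.n + 1 : ℕ) (Function.update x.u x.n σ) := by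
  by_cases h : x.n + 1 = 0
  · have hN := fin_add_one_eq_zero_iff.1 h
    rw [liftNext_of_last h, liftValue_mk hπl hV, nestedLowerExpectation_of_le hN.ge, hN,
      Nat.sub_self, pow_zero, one_mul]
  · exact liftValue_liftNext_of_not_last h σ

theorem isBellmanSolution_liftValue (hπl : πl ∈ liftedPolicies s₀ a₀ π)
    (hV : IsBellmanSolution (fun u => R.r (R.φ u (π u))) R.γ
      (fun u W => nestedLowerExpectation (R.ambiguity (R.φ u (π u))) W 0 u) V) :
    IsBellmanSolution (fun x => (R.lift s₀ a₀).r ((R.lift s₀ a₀).φ x (πl x))) (R.lift s₀ a₀).γ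
      (fun x => lowerExpectation
        (couplings ((R.lift s₀ a₀).ambiguity ((R.lift s₀ a₀).φ x (πl x)))))
      (R.liftValue s₀ a₀ πl V) := by
  intro (x : LiftState S A)
  have hexp : N - x.n.val = N - (x.n.val + 1) + 1 := by omega
  beta_reduce
  rw [lowerExpectation_couplings_lift_ambiguity]
  simp only [liftValue_liftNext hπl hV]
  rw [lowerExpectation_const_mul _ (pow_nonneg (R.lift s₀ a₀).γ_pos.le _),
    ← nestedLowerExpectation_val, ← mul_assoc, ← pow_succ', ← hexp]
  rfl

theorem L_eq_expectation (hπl : πl ∈ liftedPolicies s₀ a₀ π)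
    (hV : IsBellmanSolution (fun u => R.r (R.φ u (π u))) R.γ
      (fun u W => nestedLowerExpectation (R.ambiguity (R.φ u (π u))) W 0 u) V) :
    R.L s₀ a₀ πl = expectation (productDistribution R.q) V := by
  rw [L, NF_eq_expectation (isBellmanSolution_liftValue hπl hV),
    expectation_productDistribution_lift_q]
  simp only [liftValue_mk hπl hV]

theorem NF_le_L (hπl : πl ∈ liftedPolicies s₀ a₀ π) : R.NF π ≤ R.L s₀ a₀ πl := by
  have hC := fun u => R.ambiguity_nonempty u (π u)
  have hNF := fun u => isNonlinearExpectation_lowerExpectation (couplings_nonempty (hC u))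
  have hL := fun u => isNonlinearExpectation_nestedLowerExpectation (hC u) 0 u
  obtain ⟨V, hV⟩ := exists_isBellmanSolution (fun u => R.r (R.φ u (π u))) R.γ_pos.le R.γ_lt_one hNF
  obtain ⟨W, hW⟩ := exists_isBellmanSolution (fun u => R.r (R.φ u (π u))) R.γ_pos.le R.γ_lt_one hL
  rw [NF_eq_expectation hV, L_eq_expectation hπl hW]
  exact expectation_mono _ (hV.mono R.γ_pos.le R.γ_lt_one hL (fun u W =>
    lowerExpectation_couplings_le_nested (hC u) (R.convex_ambiguity _) W u) hW)

theorem L_le_F (hπl : πl ∈ liftedPolicies s₀ a₀ π) : R.L s₀ a₀ πl ≤ R.F π := by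
  have hC := fun u => R.ambiguity_nonempty u (π u)
  have hL := fun u => isNonlinearExpectation_nestedLowerExpectation (hC u) 0 u
  have hF := fun u => isNonlinearExpectation_lowerExpectation (products_nonempty (hC u))
  obtain ⟨V, hV⟩ := exists_isBellmanSolution (fun u => R.r (R.φ u (π u))) R.γ_pos.le R.γ_lt_one hL
  obtain ⟨W, hW⟩ := exists_isBellmanSolution (fun u => R.r (R.φ u (π u))) R.γ_pos.le R.γ_lt_one hF
  rw [L_eq_expectation hπl hV, F_eq_expectation hW]
  exact expectation_mono _ (hV.mono R.γ_pos.le R.γ_lt_one hF (fun u W =>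
    nestedLowerExpectation_le_products (hC u) W u) hW)

end Lift

end RFMDP

/-! ### Instances with coin-tossing components -/

theorem isPolyhedron_stdSimplex (X : Type) [Fintype X] : IsPolyhedron (stdSimplex ℝ X) := by
  classical
  let e := Fintype.equivFin (X ⊕ Bool)
  refine ⟨Fintype.card (X ⊕ Bool),
    fun k x => Sum.elim (fun z => if z = x then -1 else 0) (fun b => if b then 1 else -1)
      (e.symm k),
    fun k => Sum.elim (fun _ => 0) (fun b => if b then 1 else -1) (e.symm k), ?_⟩
  ext x
  simp only [stdSimplex, Set.mem_ofPred_eq, Pi.le_def, Matrix.mulVec, dotProduct]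
  rw [← e.forall_congr_right]
  simp only [Equiv.symm_apply_apply, Sum.forall, Sum.elim_inl, Sum.elim_inr, ite_mul, one_mul,
    neg_mul, zero_mul, Finset.sum_ite_eq, Finset.mem_univ, if_true, Bool.forall_bool,
    Bool.false_eq_true, if_false, Finset.sum_neg_distrib, neg_le_neg_iff, Left.neg_nonpos_iff]
  exact and_congr Iff.rfl ⟨fun h => ⟨h.ge, h.le⟩, fun h => le_antisymm h.2 h.1⟩

/-- The uniform distribution on two points. -/
def fairCoin : stdSimplex ℝ Bool :=
  ⟨fun _ => 1 / 2, fun _ => by norm_num, by norm_num [Fintype.sum_bool]⟩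

theorem expectation_fairCoin (f : Bool → ℝ) :
    expectation fairCoin f = (f true + f false) / 2 := by
  change ∑ b, 1 / 2 * f b = _
  rw [Fintype.sum_bool]
  ring

section CoinSet

variable {N : ℕ} {D : Finset (Fin N)} {i : Fin N}

/-- The marginal ambiguity sets that fix the sub-states in `D` to fair coins and leave the
distributions of all other sub-states unrestricted. -/
def coinSet (D : Finset (Fin N)) (i : Fin N) : Set (stdSimplex ℝ Bool) :=
  if i ∈ D then {fairCoin} else Set.univ

theorem coinSet_of_mem (h : i ∈ D) : coinSet D i = {fairCoin} := if_pos h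

theorem eq_fairCoin_of_mem_coinSet (h : i ∈ D) {p : stdSimplex ℝ Bool} (hp : p ∈ coinSet D i) :
    p = fairCoin :=
  Set.mem_singleton_iff.1 (coinSet_of_mem h ▸ hp)

theorem coinSet_of_notMem (h : i ∉ D) : coinSet D i = Set.univ := if_neg h

theorem coinSet_univ : coinSet (Finset.univ : Finset (Fin N)) = fun _ => {fairCoin} :=
  funext fun i => coinSet_of_mem (Finset.mem_univ i)

theorem fairCoin_mem_coinSet : fairCoin ∈ coinSet D i := by
  unfold coinSet
  split_ifs
  exacts [rfl, trivial]

theorem coinSet_nonempty (D : Finset (Fin N)) (i : Fin N) : (coinSet D i).Nonempty :=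
  ⟨fairCoin, fairCoin_mem_coinSet⟩

theorem isPolyhedron_image_coinSet : IsPolyhedron (Subtype.val '' coinSet D i) := by
  unfold coinSet
  split_ifs
  · rw [Set.image_singleton]
    exact isPolyhedron_singleton _
  · rw [Set.image_univ, Subtype.range_coe]
    exact isPolyhedron_stdSimplex Bool

end CoinSet

/-- The binary instance with rewards `c(s)` that starts in the zero state and draws the next
sub-states according to `coinSet D`, whatever the current state and action are. -/
def coinRFMDP {N : ℕ} (D : Finset (Fin N)) (c : (Fin N → Bool) → ℝ) (γ : Set.Ioo (0 : ℝ) 1) :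
    BinaryRFMDP N (Finset.univ : Finset (Fin 1 → Bool)) N where
  φ s _ := s
  q _ := pointMass false
  P i _ := Subtype.val '' coinSet D i
  P_subset _ _ := Subtype.coe_image_subset _ _
  P_polyhedral _ _ := isPolyhedron_image_coinSet
  P_nonempty i _ _ := (coinSet_nonempty D i).image _
  r := c
  γ := γ
  γ_pos := γ.2.1
  γ_lt_one := γ.2.2

namespace coinRFMDP

variable {N : ℕ} {D : Finset (Fin N)} {c : (Fin N → Bool) → ℝ} {γ : Set.Ioo (0 : ℝ) 1} {κ : ℝ}

theorem ambiguity_eq (f : Fin N → Bool) : (coinRFMDP D c γ).ambiguity f = coinSet D :=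
  funext fun _ => Set.preimage_image_eq _ Subtype.val_injective

theorem expectation_initial (V : (Fin N → Bool) → ℝ) :
    expectation (productDistribution (coinRFMDP D c γ).q) V = V fun _ => false := by
  rw [← expectation_pointMass (fun _ : Fin N => false) V, ← productDistribution_pointMass]
  rfl

variable {π : (Fin N → Bool) → (Finset.univ : Finset (Fin 1 → Bool))}

theorem NF_eq (hc : c (fun _ => false) = 0)
    (hκ : lowerExpectation (couplings (coinSet D)) c = κ) :
    (coinRFMDP D c γ).NF π = γ.1 * (1 - γ.1)⁻¹ * κ := by
  refine (RFMDP.NF_eq_expectation (V := fun s => c s + γ.1 * (1 - γ.1)⁻¹ * κ) ?_).trans ?_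
  · simp only [ambiguity_eq]
    exact isBellmanSolution_of_forall_eq γ.2.2 (fun _ =>
      isNonlinearExpectation_lowerExpectation (couplings_nonempty (coinSet_nonempty D))) fun _ => hκ
  · rw [expectation_initial, hc, zero_add]

theorem F_eq (hc : c (fun _ => false) = 0)
    (hκ : lowerExpectation (products (coinSet D)) c = κ) :
    (coinRFMDP D c γ).F π = γ.1 * (1 - γ.1)⁻¹ * κ := by
  refine (RFMDP.F_eq_expectation (V := fun s => c s + γ.1 * (1 - γ.1)⁻¹ * κ) ?_).trans ?_
  · simp only [ambiguity_eq]
    exact isBellmanSolution_of_forall_eq γ.2.2 (fun _ =>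
      isNonlinearExpectation_lowerExpectation (products_nonempty (coinSet_nonempty D))) fun _ => hκ
  · rw [expectation_initial, hc, zero_add]

instance : Nonempty (Finset.univ : Finset (Fin 1 → Bool)) :=
  Finset.univ_nonempty.to_subtype

theorem NFopt_eq (hc : c (fun _ => false) = 0)
    (hκ : lowerExpectation (couplings (coinSet D)) c = κ) :
    (coinRFMDP D c γ).NFopt = γ.1 * (1 - γ.1)⁻¹ * κ := by
  simp only [RFMDP.NFopt, NF_eq hc hκ, ciSup_const]

theorem Fopt_eq (hc : c (fun _ => false) = 0)
    (hκ : lowerExpectation (products (coinSet D)) c = κ) :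
    (coinRFMDP D c γ).Fopt = γ.1 * (1 - γ.1)⁻¹ * κ := by
  simp only [RFMDP.Fopt, F_eq hc hκ, ciSup_const]

section Lift

variable [NeZero N] {s₀ : Fin N → Bool} {a₀ : (Finset.univ : Finset (Fin 1 → Bool))}

theorem L_eq
    {πl : LiftState (fun _ : Fin N => Bool) (Finset.univ : Finset (Fin 1 → Bool)) →
      (Finset.univ : Finset (Fin 1 → Bool))}
    (hπl : πl ∈ liftedPolicies s₀ a₀ π) (hc : c (fun _ => false) = 0)
    (hκ : ∀ u, nestedLowerExpectation (coinSet D) c 0 u = κ) :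
    (coinRFMDP D c γ).L s₀ a₀ πl = γ.1 * (1 - γ.1)⁻¹ * κ := by
  refine (RFMDP.L_eq_expectation (V := fun s => c s + γ.1 * (1 - γ.1)⁻¹ * κ) hπl ?_).trans ?_
  · simp only [ambiguity_eq]
    exact isBellmanSolution_of_forall_eq γ.2.2 (fun u =>
      isNonlinearExpectation_nestedLowerExpectation (coinSet_nonempty D) 0 u) hκ
  · rw [expectation_initial, hc, zero_add]

theorem Lopt_eq (hc : c (fun _ => false) = 0)
    (hκ : ∀ u, nestedLowerExpectation (coinSet D) c 0 u = κ) :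
    (coinRFMDP D c γ).Lopt s₀ a₀ = γ.1 * (1 - γ.1)⁻¹ * κ := by
  have hL : ∀ πl, (coinRFMDP D c γ).L s₀ a₀ πl = γ.1 * (1 - γ.1)⁻¹ * κ := fun πl =>
    L_eq (π := fun u => πl (LiftState.mk u s₀ a₀ 0)) (fun _ => rfl) hc hκ
  simp only [RFMDP.Lopt, hL, ciSup_const]

end Lift

end coinRFMDP

theorem lowerExpectation_couplings_coinSet_le {N : ℕ} (D : Finset (Fin N))
    (c : (Fin N → Bool) → ℝ) :
    lowerExpectation (couplings (coinSet D)) c ≤ (c (fun _ => true) + c fun _ => false) / 2 :=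
  (lowerExpectation_couplings_le_comonotone (fun _ => fairCoin_mem_coinSet) c).trans_eq
    (expectation_fairCoin _)

/-! ### Strictness of the inequalities -/

section Mismatch

/-- The reward `[s₀] + α [s₀ ≠ s₁] + β [s₀ ≠ s₂]`. -/
def mismatchReward (α β : ℝ) (s : Fin 3 → Bool) : ℝ :=
  (if s 0 then 1 else 0) + α * (if s 0 = s 1 then 0 else 1) + β * (if s 0 = s 2 then 0 else 1)

variable {α β : ℝ}

theorem mismatchReward_vec (α β : ℝ) (x y z : Bool) :
    mismatchReward α β ![x, y, z] =
      (if x then 1 else 0) + α * (if x = y then 0 else 1) + β * (if x = z then 0 else 1) :=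
  rfl

theorem mismatchReward_false (α β : ℝ) : mismatchReward α β (fun _ => false) = 0 := by
  simp [mismatchReward]

theorem lowerExpectation_couplings_mismatchReward (hα : 0 ≤ α) (hβ : 0 ≤ β) :
    lowerExpectation (couplings (coinSet {0, 1})) (mismatchReward α β) = 1 / 2 := by
  have hne : (couplings (coinSet ({0, 1} : Finset (Fin 3)))).Nonempty :=
    couplings_nonempty (coinSet_nonempty _)
  refine le_antisymm ?_ (le_lowerExpectation hne fun p hp => ?_)
  · exact (lowerExpectation_couplings_coinSet_le _ _).trans_eq (by simp [mismatchReward])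
  · have hmarg : marginal p 0 = fairCoin := eq_fairCoin_of_mem_coinSet (by simp) (hp 0)
    calc (1 / 2 : ℝ) = expectation p fun s => if s 0 then 1 else 0 := by
          rw [← expectation_marginal p 0 fun b => if b then 1 else 0, hmarg, expectation_fairCoin]
          norm_num
      _ ≤ expectation p (mismatchReward α β) := expectation_mono p fun s => by
          rw [mismatchReward, add_assoc, le_add_iff_nonneg_right]
          positivity

theorem nestedLowerExpectation_mismatchReward (hβ : 0 ≤ β) (u : Fin 3 → Bool) :
    nestedLowerExpectation (coinSet {0, 1}) (mismatchReward α β) 0 u = (1 + α) / 2 := by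
  have hcopy : ∀ σ₀ σ₁, lowerExpectation Set.univ
      (fun σ₂ => mismatchReward α β ![σ₀, σ₁, σ₂]) = mismatchReward α β ![σ₀, σ₁, σ₀] :=
    fun σ₀ σ₁ => lowerExpectation_univ_eq_of_forall_le
      (f := fun σ₂ => mismatchReward α β ![σ₀, σ₁, σ₂]) fun σ₂ => by
        rw [mismatchReward_vec, mismatchReward_vec, if_pos rfl, mul_zero, add_zero]
        exact le_add_of_nonneg_right (by positivity)
  rw [nestedLowerExpectation_fin_three, coinSet_of_mem (by simp), coinSet_of_mem (by simp),
    coinSet_of_notMem (by decide)]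
  simp only [hcopy, lowerExpectation_singleton, expectation_fairCoin]
  simp only [mismatchReward_vec, if_true, Bool.true_eq_false, Bool.false_eq_true, if_false]
  ring

theorem lowerExpectation_products_mismatchReward :
    lowerExpectation (products (coinSet {0, 1})) (mismatchReward α β) = (1 + α + β) / 2 := by
  refine lowerExpectation_eq_of_forall_eq (products_nonempty (coinSet_nonempty _)) ?_
  rintro _ ⟨q, hq, rfl⟩
  have h0 : q 0 = fairCoin := eq_fairCoin_of_mem_coinSet (by simp) (hq 0 trivial)
  have h1 : q 1 = fairCoin := eq_fairCoin_of_mem_coinSet (by simp) (hq 1 trivial)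
  have h2 : q 2 true + q 2 false = 1 := (Fintype.sum_bool _).symm.trans (q 2).2.2
  have hnested := nestedLowerExpectation_singleton q (mismatchReward α β) 0 fun _ => false
  rw [splice_zero, nestedLowerExpectation_fin_three] at hnested
  simp only [lowerExpectation_singleton] at hnested
  rw [← hnested, h0, h1]
  simp only [expectation_fairCoin]
  simp only [expectation, Fintype.sum_bool, mismatchReward_vec, if_true, Bool.true_eq_false,
    Bool.false_eq_true, if_false]
  linear_combination (1 + α + β) / 2 * h2

/-- The instance with reward `mismatchReward α β` and discount factor `1 / 2` whose first two
sub-states are fair coins. -/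
def mismatchRFMDP (α β : ℝ) : BinaryRFMDP 3 (Finset.univ : Finset (Fin 1 → Bool)) 3 :=
  coinRFMDP {0, 1} (mismatchReward α β) ⟨1 / 2, by norm_num⟩

namespace mismatchRFMDP

variable {π : (Fin 3 → Bool) → (Finset.univ : Finset (Fin 1 → Bool))}

theorem NF_eq (hα : 0 ≤ α) (hβ : 0 ≤ β) : (mismatchRFMDP α β).NF π = 1 / 2 :=
  (coinRFMDP.NF_eq (mismatchReward_false α β)
    (lowerExpectation_couplings_mismatchReward hα hβ)).trans (by norm_num)

theorem L_eq {s₀ a₀ πl} (hπl : πl ∈ liftedPolicies s₀ a₀ π) (hβ : 0 ≤ β) :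
    (mismatchRFMDP α β).L s₀ a₀ πl = (1 + α) / 2 :=
  (coinRFMDP.L_eq hπl (mismatchReward_false α β)
    (nestedLowerExpectation_mismatchReward hβ)).trans (by norm_num)

theorem F_eq : (mismatchRFMDP α β).F π = (1 + α + β) / 2 :=
  (coinRFMDP.F_eq (mismatchReward_false α β)
    lowerExpectation_products_mismatchReward).trans (by norm_num)

end mismatchRFMDP

end Mismatch

/-! ### A lift that is as conservative as the non-factored model -/

section Pairs

variable {N : ℕ}

/-- The first partner `i` of the `i`-th pair of sub-states. -/
def pairLow (i : Fin (N / 2)) : Fin N := ⟨i, by omega⟩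

/-- The second partner `i + N / 2` of the `i`-th pair of sub-states. -/
def pairHigh (i : Fin (N / 2)) : Fin N := ⟨i + N / 2, by omega⟩

/-- The first partners of all pairs of sub-states. -/
def lowHalf (N : ℕ) : Finset (Fin N) := Finset.univ.filter fun i => i.val < N / 2

theorem mem_lowHalf {i : Fin N} : i ∈ lowHalf N ↔ i.val < N / 2 := by
  rw [lowHalf, Finset.mem_filter, and_iff_right (Finset.mem_univ i)]

/-- The reward that is `0` if both partners agree in all pairs of sub-states, and `1` otherwise. -/
def pairReward (s : Fin N → Bool) : ℝ :=
  if ∀ i : Fin (N / 2), s (pairLow i) = s (pairHigh i) then 0 else 1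

theorem pairReward_eq_zero_or_one (s : Fin N → Bool) : pairReward s = 0 ∨ pairReward s = 1 :=
  ite_eq_or_eq _ _ _

theorem pairReward_false : pairReward (fun _ : Fin N => false) = 0 :=
  if_pos fun _ => rfl

/-- The second partner of each pair is drawn after the first one, which it can copy. -/
theorem nestedLowerExpectation_pairReward_nonpos (u : Fin N → Bool) :
    nestedLowerExpectation (coinSet (lowHalf N)) pairReward 0 u ≤ 0 := by
  let I (n : ℕ) (u : Fin N → Bool) : Prop :=
    ∀ i : Fin (N / 2), i.val + N / 2 < n → u (pairLow i) = u (pairHigh i)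
  have hlast : ∀ u, I N u → pairReward u ≤ 0 := fun u hu =>
    (if_pos fun i => hu i (pairHigh i).isLt).le
  have hstep : ∀ (k : Fin N) u, I k u → ∃ p ∈ coinSet (lowHalf N) k, ∀ σ, p σ ≠ 0 →
      I (k + 1) (Function.update u k σ) := fun k u hu => by
    by_cases hk : k.val < N / 2
    · exact ⟨fairCoin, fairCoin_mem_coinSet, fun σ _ i hi => by omega⟩
    refine ⟨pointMass (u ⟨k - N / 2, by omega⟩), ?_, fun σ hσ i hi => ?_⟩
    · rw [coinSet_of_notMem (mem_lowHalf.not.2 hk)]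
      exact Set.mem_univ _
    have hcopy : σ = u ⟨k - N / 2, by omega⟩ := by
      by_contra hne
      exact hσ (by rw [pointMass_apply, if_neg hne])
    have hlow : pairLow i ≠ k := fun h => hk (h ▸ i.isLt)
    rw [Function.update_of_ne hlow]
    rcases eq_or_ne (pairHigh i) k with rfl | hhigh
    · rw [Function.update_self, hcopy]
      exact congrArg u (Fin.ext (Nat.add_sub_cancel ..).symm)
    · rw [Function.update_of_ne hhigh]
      exact hu i (lt_of_le_of_ne (Nat.lt_succ_iff.1 hi) (Fin.val_ne_of_ne hhigh))
  exact nestedLowerExpectation_le_of_invariant hlast hstep N.zero_le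
    fun i hi => absurd hi (Nat.not_lt_zero _)

theorem lowerExpectation_couplings_pairReward_nonneg :
    0 ≤ lowerExpectation (couplings (coinSet (lowHalf N))) pairReward :=
  lowerExpectation_nonneg fun _ => ite_nonneg le_rfl zero_le_one

theorem lowerExpectation_couplings_pairReward_le_nested (u : Fin N → Bool) :
    lowerExpectation (couplings (coinSet (lowHalf N))) pairReward ≤
      nestedLowerExpectation (coinSet (lowHalf N)) pairReward 0 u :=
  lowerExpectation_couplings_le_nested (coinSet_nonempty _)
    (fun _ => isPolyhedron_image_coinSet.convex) _ u

theorem nestedLowerExpectation_pairReward (u : Fin N → Bool) :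
    nestedLowerExpectation (coinSet (lowHalf N)) pairReward 0 u = 0 :=
  le_antisymm (nestedLowerExpectation_pairReward_nonpos u)
    (lowerExpectation_couplings_pairReward_nonneg.trans
      (lowerExpectation_couplings_pairReward_le_nested u))

theorem lowerExpectation_couplings_pairReward :
    lowerExpectation (couplings (coinSet (lowHalf N))) pairReward = 0 :=
  le_antisymm ((lowerExpectation_couplings_pairReward_le_nested fun _ => false).trans
    (nestedLowerExpectation_pairReward_nonpos _)) lowerExpectation_couplings_pairReward_nonneg

/-- Flips the first partners of the pairs selected by `t`. -/
def flipLow (t : Fin (N / 2) → Bool) (s : Fin N → Bool) : Fin N → Bool :=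
  fun i => if h : i.val < N / 2 then xor (s i) (t ⟨i, h⟩) else s i

theorem flipLow_involutive (t : Fin (N / 2) → Bool) :
    Function.Involutive (flipLow t : (Fin N → Bool) → Fin N → Bool) := by
  intro s
  ext i
  by_cases h : i.val < N / 2 <;> simp [flipLow, h]

theorem pairReward_flipLow (t : Fin (N / 2) → Bool) (s : Fin N → Bool) :
    pairReward (flipLow t s) =
      if t = fun i => xor (s (pairLow i)) (s (pairHigh i)) then 0 else 1 := by
  have hagree : ∀ i, flipLow t s (pairLow i) = flipLow t s (pairHigh i) ↔
      t i = xor (s (pairLow i)) (s (pairHigh i)) := fun i => by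
    have hlow : flipLow t s (pairLow i) = xor (s (pairLow i)) (t i) := by simp [flipLow, pairLow]
    have hhigh : flipLow t s (pairHigh i) = s (pairHigh i) := by simp [flipLow, pairHigh]
    rw [hlow, hhigh]
    generalize s (pairLow i) = x, s (pairHigh i) = y, t i = z
    revert x y z
    decide
  simp only [pairReward, hagree, funext_iff]

theorem sum_pairReward_flipLow (s : Fin N → Bool) :
    ∑ t, pairReward (flipLow t s) = 2 ^ (N / 2) - 1 := by
  have hcompl : ∀ t, pairReward (flipLow t s) =
      1 - if t = fun i => xor (s (pairLow i)) (s (pairHigh i)) then 1 else 0 := fun t => by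
    rw [pairReward_flipLow]
    split_ifs <;> norm_num
  simp [hcompl]

theorem productDistribution_flipLow {q : Fin N → stdSimplex ℝ Bool}
    (hq : ∀ i ∈ lowHalf N, q i = fairCoin) (t : Fin (N / 2) → Bool) (s : Fin N → Bool) :
    productDistribution q (flipLow t s) = productDistribution q s := by
  change ∏ i, q i (flipLow t s i) = ∏ i, q i (s i)
  refine Finset.prod_congr rfl fun i _ => ?_
  by_cases h : i.val < N / 2
  · rw [hq i (mem_lowHalf.2 h)]
    rfl
  · rw [flipLow, dif_neg h]

/-- Averages over the flips of the first partners, exactly one of which makes all pairs agree. -/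
theorem expectation_pairReward {q : Fin N → stdSimplex ℝ Bool}
    (hq : ∀ i ∈ lowHalf N, q i = fairCoin) :
    expectation (productDistribution q) pairReward = 1 - (2 ^ (N / 2))⁻¹ := by
  have hflip : ∀ t, expectation (productDistribution q) (fun s => pairReward (flipLow t s)) =
      expectation (productDistribution q) pairReward := fun t => by
    refine Fintype.sum_equiv (flipLow_involutive t).toPerm _ _ fun s => ?_
    rw [Function.Involutive.coe_toPerm, productDistribution_flipLow hq]
  have hsum : (2 : ℝ) ^ (N / 2) * expectation (productDistribution q) pairReward =
      2 ^ (N / 2) - 1 := by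
    calc (2 : ℝ) ^ (N / 2) * expectation (productDistribution q) pairReward
        = ∑ t, expectation (productDistribution q) fun s => pairReward (flipLow t s) := by
          simp [hflip]
      _ = expectation (productDistribution q) fun s => ∑ t, pairReward (flipLow t s) := by
          simp only [expectation, Finset.mul_sum]
          exact Finset.sum_comm
      _ = 2 ^ (N / 2) - 1 := by simp only [sum_pairReward_flipLow, expectation_const]
  rw [← mul_right_inj' (pow_ne_zero (N / 2) (two_ne_zero' ℝ)), hsum, mul_sub, mul_one,
    mul_inv_cancel₀ (by positivity)]

theorem lowerExpectation_products_pairReward :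
    lowerExpectation (products (coinSet (lowHalf N))) pairReward = 1 - (2 ^ (N / 2))⁻¹ := by
  refine lowerExpectation_eq_of_forall_eq (products_nonempty (coinSet_nonempty _)) ?_
  rintro _ ⟨q, hq, rfl⟩
  exact expectation_pairReward fun i hi => eq_fairCoin_of_mem_coinSet hi (hq i trivial)

namespace coinRFMDP

variable {γ : Set.Ioo (0 : ℝ) 1}

theorem NFopt_pairReward : (coinRFMDP (lowHalf N) pairReward γ).NFopt = 0 := by
  rw [NFopt_eq pairReward_false lowerExpectation_couplings_pairReward, mul_zero]

theorem Lopt_pairReward [NeZero N] {s₀ a₀} :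
    (coinRFMDP (lowHalf N) pairReward γ).Lopt s₀ a₀ = 0 := by
  rw [Lopt_eq pairReward_false nestedLowerExpectation_pairReward, mul_zero]

theorem Fopt_pairReward : (coinRFMDP (lowHalf N) pairReward γ).Fopt =
    γ.1 * (1 - γ.1)⁻¹ * (1 - (2 ^ (N / 2))⁻¹) :=
  Fopt_eq pairReward_false lowerExpectation_products_pairReward

end coinRFMDP

end Pairs

/-! ### A lift that is as tight as the factored model -/

section Consensus

variable {N : ℕ}

/-- The reward that is `0` if all sub-states agree, and `1` otherwise. -/
def consensusReward (s : Fin N → Bool) : ℝ := if ∀ i j, s i = s j then 0 else 1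

theorem consensusReward_eq_zero_or_one (s : Fin N → Bool) :
    consensusReward s = 0 ∨ consensusReward s = 1 :=
  ite_eq_or_eq _ _ _

theorem consensusReward_const (b : Bool) : consensusReward (fun _ : Fin N => b) = 0 :=
  if_pos fun _ _ => rfl

theorem lowerExpectation_couplings_consensusReward :
    lowerExpectation (couplings (coinSet Finset.univ)) (consensusReward (N := N)) = 0 := by
  refine le_antisymm ?_ (lowerExpectation_nonneg fun s => ite_nonneg le_rfl zero_le_one)
  exact (lowerExpectation_couplings_coinSet_le _ _).trans_eq (by simp [consensusReward_const])

theorem coinRFMDP.NFopt_consensusReward {γ : Set.Ioo (0 : ℝ) 1} :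
    (coinRFMDP (Finset.univ : Finset (Fin N)) consensusReward γ).NFopt = 0 := by
  rw [NFopt_eq (consensusReward_const false) lowerExpectation_couplings_consensusReward, mul_zero]

variable [NeZero N]

theorem consensusReward_add_single_add_single (s : Fin N → Bool) :
    consensusReward s + ((Pi.single (fun _ => false) 1 : (Fin N → Bool) → ℝ) s +
      (Pi.single (fun _ => true) 1 : (Fin N → Bool) → ℝ) s) = 1 := by
  rcases em (∃ b, s = fun _ => b) with ⟨b, rfl⟩ | hs
  · cases b <;> simp [consensusReward_const, funext_iff]
  · have hne : ¬∀ i j, s i = s j := fun h => hs ⟨s 0, funext fun i => h i 0⟩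
    rw [not_exists] at hs
    simp [consensusReward, hne, hs]

theorem expectation_productDistribution_fairCoin_consensusReward :
    expectation (productDistribution fun _ : Fin N => fairCoin) consensusReward =
      1 - (2 ^ (N - 1))⁻¹ := by
  set p := productDistribution fun _ : Fin N => fairCoin
  have hpoint : ∀ b, expectation p (Pi.single (fun _ => b) 1) = (2 ^ (N - 1))⁻¹ / 2 := fun b => by
    calc expectation p (Pi.single (fun _ => b) 1) = ∏ _i : Fin N, 1 / 2 :=
          expectation_pi_single p _
      _ = (2 ^ (N - 1))⁻¹ / 2 := by
          rw [Finset.prod_const, Finset.card_univ, Fintype.card_fin, one_div, inv_pow,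
            ← pow_sub_one_mul (NeZero.ne N), mul_inv, div_eq_mul_inv]
  have hsum : expectation p consensusReward + (expectation p (Pi.single (fun _ => false) 1) +
      expectation p (Pi.single (fun _ => true) 1)) = 1 := by
    simp only [← expectation_add, consensusReward_add_single_add_single, expectation_const]
  rw [hpoint, hpoint, add_halves] at hsum
  exact eq_sub_of_add_eq hsum

theorem nestedLowerExpectation_consensusReward (u : Fin N → Bool) :
    nestedLowerExpectation (coinSet Finset.univ) consensusReward 0 u = 1 - (2 ^ (N - 1))⁻¹ := by
  rw [coinSet_univ, nestedLowerExpectation_singleton, splice_zero,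
    expectation_productDistribution_fairCoin_consensusReward]

theorem lowerExpectation_products_consensusReward :
    lowerExpectation (products (coinSet Finset.univ)) (consensusReward (N := N)) =
      1 - (2 ^ (N - 1))⁻¹ := by
  refine lowerExpectation_eq_of_forall_eq (products_nonempty (coinSet_nonempty _)) ?_
  rintro _ ⟨q, hq, rfl⟩
  have hq' : q = fun _ => fairCoin :=
    funext fun i => eq_fairCoin_of_mem_coinSet (Finset.mem_univ i) (hq i trivial)
  rw [hq', expectation_productDistribution_fairCoin_consensusReward]

namespace coinRFMDP

variable {γ : Set.Ioo (0 : ℝ) 1}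

theorem Lopt_consensusReward {s₀ a₀} :
    (coinRFMDP (Finset.univ : Finset (Fin N)) consensusReward γ).Lopt s₀ a₀ =
      γ.1 * (1 - γ.1)⁻¹ * (1 - (2 ^ (N - 1))⁻¹) :=
  Lopt_eq (consensusReward_const false) nestedLowerExpectation_consensusReward

theorem Fopt_consensusReward :
    (coinRFMDP (Finset.univ : Finset (Fin N)) consensusReward γ).Fopt =
      γ.1 * (1 - γ.1)⁻¹ * (1 - (2 ^ (N - 1))⁻¹) :=
  Fopt_eq (consensusReward_const false) lowerExpectation_products_consensusReward

end coinRFMDP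

end Consensus

end

theorem mainTheorem5 :
    -- (i), the inequalities
    (∀ (N : ℕ) [NeZero N] (S : Fin N → Type) [∀ n, Fintype (S n)] (A : Type) [Fintype A]
      (Φ : Type) (R : RFMDP S A Φ) (s₀ : ∀ n, S n) (a₀ : A) (π : (∀ n, S n) → A),
      ∀ πl ∈ liftedPolicies s₀ a₀ π, R.NF π ≤ R.L s₀ a₀ πl ∧ R.L s₀ a₀ πl ≤ R.F π) ∧
    -- (i), none of the inequalities is tight
    (∃ (N : ℕ) (_ : NeZero N) (k F : ℕ) (A : Finset (Fin k → Bool)) (R : BinaryRFMDP N A F)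
      (π : (Fin N → Bool) → A),
      ∀ s₀ a₀, ∀ πl ∈ liftedPolicies s₀ a₀ π,
        R.NF π < R.L s₀ a₀ πl ∧ R.L s₀ a₀ πl < R.F π) ∧
    -- (i), only the first inequality is tight
    (∃ (N : ℕ) (_ : NeZero N) (k F : ℕ) (A : Finset (Fin k → Bool)) (R : BinaryRFMDP N A F)
      (π : (Fin N → Bool) → A),
      ∀ s₀ a₀, ∀ πl ∈ liftedPolicies s₀ a₀ π,
        R.NF π = R.L s₀ a₀ πl ∧ R.L s₀ a₀ πl < R.F π) ∧
    -- (i), only the second inequality is tight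
    (∃ (N : ℕ) (_ : NeZero N) (k F : ℕ) (A : Finset (Fin k → Bool)) (R : BinaryRFMDP N A F)
      (π : (Fin N → Bool) → A),
      ∀ s₀ a₀, ∀ πl ∈ liftedPolicies s₀ a₀ π,
        R.NF π < R.L s₀ a₀ πl ∧ R.L s₀ a₀ πl = R.F π) ∧
    -- (i), both inequalities are tight
    (∃ (N : ℕ) (_ : NeZero N) (k F : ℕ) (A : Finset (Fin k → Bool)) (R : BinaryRFMDP N A F)
      (π : (Fin N → Bool) → A),
      ∀ s₀ a₀, ∀ πl ∈ liftedPolicies s₀ a₀ π,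
        R.NF π = R.L s₀ a₀ πl ∧ R.L s₀ a₀ πl = R.F π) ∧
    -- (ii)
    (∀ (N : ℕ) [NeZero N] (γ : ℝ), 0 < γ → γ < 1 →
      ∃ (k F : ℕ) (A : Finset (Fin k → Bool)) (R : BinaryRFMDP N A F),
        A.Nonempty ∧ R.γ = γ ∧ R.ZeroOneRewards ∧ R.NFopt = 0 ∧ (∀ s₀ a₀, R.Lopt s₀ a₀ = 0) ∧
        R.Fopt = γ * (1 - γ)⁻¹ * (1 - ((2 : ℝ) ^ (N / 2))⁻¹)) ∧
    -- (iii)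
    (∀ (N : ℕ) [NeZero N] (γ : ℝ), 0 < γ → γ < 1 →
      ∃ (k F : ℕ) (A : Finset (Fin k → Bool)) (R : BinaryRFMDP N A F),
        A.Nonempty ∧ R.γ = γ ∧ R.ZeroOneRewards ∧ R.NFopt = 0 ∧
        (∀ s₀ a₀, R.Lopt s₀ a₀ = γ * (1 - γ)⁻¹ * (1 - ((2 : ℝ) ^ (N - 1))⁻¹)) ∧
        R.Fopt = γ * (1 - γ)⁻¹ * (1 - ((2 : ℝ) ^ (N - 1))⁻¹)) := by
  let π : (Fin 3 → Bool) → (Finset.univ : Finset (Fin 1 → Bool)) := fun _ => ⟨0, Finset.mem_univ 0⟩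
  refine ⟨fun N _ S _ A _ Φ R s₀ a₀ π πl hπl => ⟨R.NF_le_L hπl, R.L_le_F hπl⟩,
    ⟨3, inferInstance, 1, 3, _, mismatchRFMDP 1 1, π, fun s₀ a₀ πl hπl => ?_⟩,
    ⟨3, inferInstance, 1, 3, _, mismatchRFMDP 0 1, π, fun s₀ a₀ πl hπl => ?_⟩,
    ⟨3, inferInstance, 1, 3, _, mismatchRFMDP 1 0, π, fun s₀ a₀ πl hπl => ?_⟩,
    ⟨3, inferInstance, 1, 3, _, mismatchRFMDP 0 0, π, fun s₀ a₀ πl hπl => ?_⟩,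
    fun N _ γ hγ hγ1 => ?_, fun N _ γ hγ hγ1 => ?_⟩
  iterate 4
    · norm_num [mismatchRFMDP.NF_eq, mismatchRFMDP.L_eq hπl, mismatchRFMDP.F_eq]
  · exact ⟨1, N, Finset.univ, coinRFMDP (lowHalf N) pairReward ⟨γ, hγ, hγ1⟩, Finset.univ_nonempty,
      rfl, fun s _ => pairReward_eq_zero_or_one s, coinRFMDP.NFopt_pairReward,
      fun s₀ a₀ => coinRFMDP.Lopt_pairReward, coinRFMDP.Fopt_pairReward⟩
  · exact ⟨1, N, Finset.univ, coinRFMDP Finset.univ consensusReward ⟨γ, hγ, hγ1⟩,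
      Finset.univ_nonempty, rfl, fun s _ => consensusReward_eq_zero_or_one s,
      coinRFMDP.NFopt_consensusReward, fun s₀ a₀ => coinRFMDP.Lopt_consensusReward,
      coinRFMDP.Fopt_consensusReward⟩
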